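/- Let $n\ge 0$, let $\mathcal G$ be a finite groupoid (for instance a finite group) and let $R$ be a commutative ring. For a groupoid $\mathcal H$ let $\mathcal I^n(\mathcal H)=\mathrm{Hom}(\mathbb Z^n,\mathcal H)$ be the groupoid of objects with $n$ commuting automorphisms (arrows: simultaneous conjugation), and let $n\text{-}\mathrm{Class}(\mathcal H)$ be the $R$-algebra of $R$-valued functions on $\mathcal I^n(\mathcal H)$ constant on isomorphism classes, with transfers along faithful maps $F$ given by $(F_*f)(y)=\sum_{[x]\mapsto[y]}\frac{|\mathrm{aut}\,y|}{|\mathrm{aut}\,x|}f(x)$, the automorphism groups being those in the inertia groupoids. Let $S_k\wr\mathcal G$ be the $k$-th symmetric power of $\mathcal G$ (objects: $k$-tuples of objects; arrows: a permutation $\sigma$ and arrows $x_i\to y_{\sigma(i)}$), and let $$S_{n\text{-}\mathrm{Class}}(\mathcal G)=\prod_{k\ge0} n\text{-}\mathrm{Class}(S_k\wr\mathcal G)\,t^k,$$ with its pointwise product (juxtaproduct, unit $\mathbf 1=\sum 1_k t^k$) and its graded cross product $\times$ given by transfer along $(S_a\wr\mathcal G)\times(S_b\wr\mathcal G)\to S_{a+b}\wr\mathcal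 G$ (unit $1=1_0$). Let $\mathcal G\text{-}\mathrm{Cov}^{fin}(T^n)$ be the groupoid of composites $P\xrightarrow{\pi}Y\xrightarrow{\phi}T^n$ of a principal $\mathcal G$-bundle $\pi$ and a finite cover $\phi$ of the $n$-torus, with the $\mathcal G$-equivariant homeomorphisms over $T^n$ as morphisms. 1. There is an equivalence of groupoids $\coprod_{k\ge0}\mathcal I^n(S_k\wr\mathcal G)\simeq\mathcal G\text{-}\mathrm{Cov}^{fin}(T^n)$, under which the $k$-th summand corresponds to the $k$-fold covers and an object of $\mathcal I^n(S_k\wr\mathcal G)$ goes to a cover with this holonomy: if the object is given by $x_1,\dots,x_k$ and arrows $g_{j,i}\colon x_i\to x_{\sigma_j(i)}$ $(1\le j\le n)$, there are points $p_i\in P$ with anchor $x_i$ over the base point whose images number the fibre of $Y$ there, such that the lift to $P$ of the $j$-th standard loop starting at $p_i$ ends at $g_{j,i}^{-1}p_{\sigma_j(i)}$. 2. Pulling back along this equivalence identifies $S_{n\text{-}\mathrm{Class}}(\mathcal G)$ with the $R$-algebra of isomorphism-invariant $R$-valued functions on $\mathcal G\text{-}\mathrm{Cov}^{fin}(T^n)$.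 The juxtaproduct is the pointwise product, and the cross product is $$(s\times t)(P\to Y\to T^n)=\sum_{Y=U\sqcup U'}s(P|_U\to U\to T^n)\,t(P|_{U'}\to U'\to T^n),$$ the sum being over ordered decompositions of $Y$ into two open and closed subsets; its unit is the indicator function of $Y=\emptyset$. 3. There are unique elements $c_k$ $(k\ge1)$ in degree $k$ with $\sum_{k\ge1}c_kt^{k-1}=\frac{d}{dt}\ln\mathbf 1$, i.e. $\mathbf 1\times\sum_{k\ge 1} c_kt^{k-1}=\frac{d}{dt}\mathbf 1$, and on $k$-fold covers $c_k(P\to Y\to T^n)$ is $k$ if $Y$ is connected and $0$ otherwise. If $R$ is a $\mathbb Q$-algebra, the coefficient $\frac1kc_k$ of $t^k$ in $\ln\mathbf 1$ (logarithm for the cross product) is the indicator function of the $k$-fold covers with $Y$ connected. 4. There are unique elements $f_k$ $(k\ge0)$ in degree $k$ with $\mathbf 1\times\sum_k(-1)^kf_kt^k=1$, and on $k$-fold covers $f_k(P\to Y\to T^n)=\prod_i(-1)^{k_i-1}$, the product being over the connected components $Y_i$ of $Y$, where $\phi|_{Y_i}$ is a $k_i$-fold cover of $T^n$. -/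

import Mathlib

open CategoryTheory

universe u v w

/-! ### Invariant functions on a groupoid, pull-back and transfer -/

/-- The `R`-algebra (with pointwise operations) of `R`-valued functions on the objects of `C` that
are constant on isomorphism classes. For a groupoid `C` this is `H⁰(BC; R)`. -/
def InvFun (C : Type*) [Category C] (R : Type*) [CommRing R] : Subalgebra R (C → R) where
  carrier := {f | ∀ x y : C, Nonempty (x ≅ y) → f x = f y}
  mul_mem' hf hg x y h := by simp [hf x y h, hg x y h]
  add_mem' hf hg x y h := by simp [hf x y h, hg x y h]
  algebraMap_mem' _ _ _ _ := rfl

instance (C : Type*) [Category C] (R : Type*) [CommRing R] :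
    CoeFun (InvFun C R) (fun _ => C → R) := ⟨fun f => f.1⟩

/-- Pull-back of invariant functions along a functor. -/
def InvFun.pullback {C D : Type*} [Category C] [Category D] {R : Type*} [CommRing R] (F : C ⥤ D)
    (f : InvFun D R) : InvFun C R :=
  ⟨fun x => f (F.obj x), fun _ _ ⟨e⟩ => f.2 _ _ ⟨F.mapIso e⟩⟩

/-- The transfer of invariant functions along a faithful map `F` of finite groupoids:
`(F_* f)(y) = ∑_{[x] ↦ [y]} (|aut y| / |aut x|) f(x)`, the sum being over the isomorphism classes
`[x]` of `C` that are sent to `[y]`. As `F` is faithful, the division of natural numbers is exact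
by Lagrange's theorem. -/
noncomputable def InvFun.transfer {C D : Type*} [Category C] [Category D] {R : Type*} [CommRing R]
    (F : C ⥤ D) (f : InvFun C R) : InvFun D R :=
  open Classical in
  ⟨fun y => ∑ᶠ q : Quotient (isIsomorphicSetoid C),
      if Nonempty (F.obj q.out ≅ y) then
        ((Nat.card (Aut y) / Nat.card (Aut q.out) : ℕ) : R) * f q.out
      else 0,
    by
      rintro y z ⟨e⟩
      refine finsum_congr fun q => ?_
      have h : Nonempty (F.obj q.out ≅ y) ↔ Nonempty (F.obj q.out ≅ z) :=
        ⟨fun ⟨a⟩ => ⟨a ≪≫ e⟩, fun ⟨a⟩ => ⟨a ≪≫ e.symm⟩⟩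
      rw [Nat.card_congr (Aut.autMulEquivOfIso e).toEquiv]
      by_cases hy : Nonempty (F.obj q.out ≅ y)
      · rw [if_pos hy, if_pos (h.1 hy)]
      · rw [if_neg hy, if_neg (mt h.2 hy)]⟩

/-! ### Iterated inertia groupoids -/

/-- The `n`-fold inertia groupoid `𝓘ⁿ(C) = Hom(ℤⁿ, C)`: an object is an object of `C` together
with `n` pairwise commuting automorphisms of it. -/
structure Inertia (n : ℕ) (C : Type*) [Groupoid C] where
  pt : C
  aut : Fin n → (pt ⟶ pt)
  comm : ∀ i j, aut i ≫ aut j = aut j ≫ aut i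

namespace Inertia

variable {n : ℕ} {C D : Type*} [Groupoid C] [Groupoid D]

/-- Arrows of the inertia groupoid are the arrows `h` of `C` with `g'ᵢ = h gᵢ h⁻¹` for all `i`. -/
@[ext]
structure Hom (x y : Inertia n C) where
  arr : x.pt ⟶ y.pt
  conj : ∀ i, x.aut i ≫ arr = arr ≫ y.aut i

instance : Groupoid (Inertia n C) where
  Hom := Hom
  id x := ⟨𝟙 _, fun i => by simp⟩
  comp f g := ⟨f.arr ≫ g.arr, fun i => by
    rw [← Category.assoc, f.conj, Category.assoc, g.conj, Category.assoc]⟩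
  inv f := ⟨Groupoid.inv f.arr, fun i => by
    have := f.conj i
    simp only [Groupoid.inv_eq_inv]
    rw [IsIso.eq_inv_comp, ← Category.assoc, ← this]
    simp⟩
  id_comp f := Hom.ext (Category.id_comp _)
  comp_id f := Hom.ext (Category.comp_id _)
  assoc f g h := Hom.ext (Category.assoc _ _ _)
  inv_comp f := Hom.ext (Groupoid.inv_comp _)
  comp_inv f := Hom.ext (Groupoid.comp_inv _)

/-- Functoriality of the inertia groupoid. -/
def map (n : ℕ) (F : C ⥤ D) : Inertia n C ⥤ Inertia n D where
  obj x := ⟨F.obj x.pt, fun i => F.map (x.aut i), fun i j => by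
    rw [← F.map_comp, x.comm, F.map_comp]⟩
  map f := ⟨F.map f.arr, fun i => by
    have := f.conj i
    simp only [← F.map_comp, this]⟩
  map_id _ := Hom.ext (F.map_id _)
  map_comp _ _ := Hom.ext (F.map_comp _ _)

end Inertia

/-! ### Symmetric powers of a groupoid -/

/-- The objects of the symmetric power `S_I ≀ 𝒢`, for a finite set `I` of indices: families of
objects of `𝒢`. For `I = Fin k` this is `S_k ≀ 𝒢`. -/
structure Wreath (I : Type*) (𝒢 : Type*) where
  pt : I → 𝒢

namespace Wreath

variable {I J K : Type*} {𝒢 : Type*} [Groupoid 𝒢]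

/-- An arrow from `(xᵢ)` to `(yᵢ)` in `S_I ≀ 𝒢` is a permutation `σ` together with arrows
`xᵢ ⟶ y_{σ(i)}` of `𝒢`. (The arrow `xᵢ ⟶ y_{σ(i)}` is recorded as `arr i j h` with
`h : σ i = j`.) -/
@[ext]
structure Hom (x y : Wreath I 𝒢) where
  perm : Equiv.Perm I
  arr : ∀ i j, perm i = j → (x.pt i ⟶ y.pt j)

theorem Hom.ext' {x y : Wreath I 𝒢} {f g : Hom x y} (h : ∀ i, f.perm i = g.perm i)
    (h' : ∀ i j (hf : f.perm i = j) (hg : g.perm i = j), f.arr i j hf = g.arr i j hg) : f = g := by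
  obtain ⟨σ, a⟩ := f
  obtain ⟨τ, b⟩ := g
  obtain rfl : σ = τ := Equiv.ext h
  congr
  funext i j hij
  exact h' i j hij hij

instance : Groupoid (Wreath I 𝒢) where
  Hom := Hom
  id x := ⟨1, fun i j h => eqToHom (congrArg x.pt h)⟩
  comp f g := ⟨g.perm * f.perm, fun i j h => f.arr i (f.perm i) rfl ≫ g.arr (f.perm i) j h⟩
  inv f := ⟨f.perm⁻¹, fun i j h => Groupoid.inv (f.arr j i (Equiv.Perm.inv_eq_iff_eq.1 h).symm)⟩
  id_comp f := Hom.ext' (fun i => rfl) fun i j _ _ => Category.id_comp _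
  comp_id f := Hom.ext' (fun i => rfl) fun i j hf hg => by
    obtain rfl : f.perm i = j := hg
    simp
  assoc f g h := Hom.ext' (fun i => rfl) fun i j _ _ => by simp
  inv_comp f := Hom.ext' (fun i => by simp) fun i j hf hg => by
    obtain rfl : i = j := hg
    simp only [Groupoid.inv_eq_inv, eqToHom_refl, IsIso.inv_comp_eq]
    simp
  comp_inv f := Hom.ext' (fun i => by simp) fun i j hf hg => by
    obtain rfl : i = j := hg
    simp

/-- The arrows of the juxtaposition of two arrows of symmetric powers. -/
def sumArr {x y : Wreath I 𝒢 × Wreath J 𝒢} (f : x ⟶ y) : ∀ a b : I ⊕ J,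
    Equiv.sumCongr f.1.perm f.2.perm a = b →
      (Sum.elim x.1.pt x.2.pt a ⟶ Sum.elim y.1.pt y.2.pt b)
  | .inl i, .inl j, h => f.1.arr i j (Sum.inl_injective h)
  | .inr i, .inr j, h => f.2.arr i j (Sum.inr_injective h)
  | .inl _, .inr _, h => (Sum.inl_ne_inr h).elim
  | .inr _, .inl _, h => (Sum.inr_ne_inl h).elim

/-- The inclusion `(S_I ≀ 𝒢) × (S_J ≀ 𝒢) → S_K ≀ 𝒢` (concatenation) induced by a bijection
`I ⊔ J ≃ K`. -/
def concat (e : I ⊕ J ≃ K) : Wreath I 𝒢 × Wreath J 𝒢 ⥤ Wreath K 𝒢 where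
  obj x := ⟨fun k => Sum.elim x.1.pt x.2.pt (e.symm k)⟩
  map f := ⟨e.permCongr (Equiv.sumCongr f.1.perm f.2.perm), fun k l h =>
    sumArr f (e.symm k) (e.symm l) (by simp [← h, Equiv.permCongr_apply])⟩
  map_id x := by
    refine Hom.ext' (fun k => ?_) fun k l hf hg => ?_
    · obtain ⟨a, rfl⟩ := e.surjective k
      rcases a with a | a <;> simp [Equiv.permCongr_apply] <;> rfl
    · obtain rfl : k = l := hg
      obtain ⟨a, rfl⟩ := e.surjective k
      have key : ∀ (b : I ⊕ J) (h), sumArr (𝟙 x) b b h = 𝟙 _ := by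
        rintro (b | b) h <;> rfl
      exact key _ _
  map_comp {x y z} f g := by
    refine Hom.ext' (fun k => ?_) fun k l hf hg => ?_
    · obtain ⟨a, rfl⟩ := e.surjective k
      rcases a with a | a
      · change e _ = e (Equiv.sumCongr g.1.perm g.2.perm (e.symm (e (Equiv.sumCongr _ _ _))))
        simp; rfl
      · change e _ = e (Equiv.sumCongr g.1.perm g.2.perm (e.symm (e (Equiv.sumCongr _ _ _))))
        simp; rfl
    · have key : ∀ (a b c : I ⊕ J) (h) (h₁) (h₂), sumArr (f ≫ g) a c h =
          sumArr f a b h₁ ≫ sumArr g b c h₂ := by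
        rintro (a | a) (b | b) (c | c) h h₁ h₂ <;> first
          | (exact (Sum.inl_ne_inr h₁).elim)
          | (exact (Sum.inr_ne_inl h₁).elim)
          | (exact (Sum.inl_ne_inr h₂).elim)
          | (exact (Sum.inr_ne_inl h₂).elim)
          | skip
        · obtain rfl : f.1.perm a = b := Sum.inl_injective h₁
          rfl
        · obtain rfl : f.2.perm a = b := Sum.inr_injective h₁
          rfl
      exact key _ _ _ _ _ _

end Wreath

/-! ### The graded algebra of `n`-class functions on symmetric powers -/

/-- The algebra of `n`-class functions on `𝒢` with values in `R`. -/
abbrev NClass (n : ℕ) (𝒢 : Type*) [Groupoid 𝒢] (R : Type*) [CommRing R] :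
    Subalgebra R (Inertia n 𝒢 → R) :=
  InvFun (Inertia n 𝒢) R

/-- `S_{n-Class}(𝒢) = ∏_{k ≥ 0} n-Class(S_k ≀ 𝒢)`. Its pointwise multiplication is the
juxtaproduct. -/
abbrev SClass (n : ℕ) (𝒢 : Type*) [Groupoid 𝒢] (R : Type*) [CommRing R] :=
  ∀ k : ℕ, NClass n (Wreath (Fin k) 𝒢) R

namespace SClass

variable {n : ℕ} {𝒢 : Type*} [Groupoid 𝒢] {R : Type*} [CommRing R]

/-- The Künneth map `n-Class(𝒢) ⊗ n-Class(ℋ) → n-Class(𝒢 × ℋ)`, `(s, t) ↦ pr₁^* s · pr₂^* t`. -/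
def kunneth {𝒢 ℋ : Type*} [Groupoid 𝒢] [Groupoid ℋ] (s : NClass n 𝒢 R) (t : NClass n ℋ R) :
    NClass n (𝒢 × ℋ) R :=
  InvFun.pullback (Inertia.map n (CategoryTheory.Prod.fst 𝒢 ℋ)) s *
    InvFun.pullback (Inertia.map n (CategoryTheory.Prod.snd 𝒢 ℋ)) t

/-- The cross product: in degree `k`, the sum over `a + b = k` of the transfers along
`(S_a ≀ 𝒢) × (S_b ≀ 𝒢) → S_k ≀ 𝒢`. -/
noncomputable def cross (s t : SClass n 𝒢 R) : SClass n 𝒢 R := fun k =>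
  ∑ p : Finset.HasAntidiagonal.antidiagonal k,
    InvFun.transfer (Inertia.map n (Wreath.concat
      (finSumFinEquiv.trans (finCongr (Finset.HasAntidiagonal.mem_antidiagonal.1 p.2)))))
      (kunneth (s p.1.1) (t p.1.2))

/-- The unit `1₀` of the cross product. -/
def crossOne : SClass n 𝒢 R := Pi.single 0 1

/-- The powers of an element for the cross product. -/
noncomputable def crossPow (s : SClass n 𝒢 R) : ℕ → SClass n 𝒢 R
  | 0 => crossOne
  | j + 1 => cross (crossPow s j) s

/-- The logarithm `∑_{j ≥ 1} (-1)^{j-1} (s - 1₀)^j / j` for the cross product, for `s` with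
degree zero part `1`; since `s - 1₀` begins in degree one, only the terms with `j ≤ k` contribute
to the coefficient of `t ^ k`. -/
noncomputable def crossLog [Algebra ℚ R] (s : SClass n 𝒢 R) : SClass n 𝒢 R := fun k =>
  ∑ j ∈ Finset.Icc 1 k, algebraMap ℚ R ((-1) ^ (j - 1) / j) • crossPow (s - crossOne) j k

/-- The family `f = (f_k)` satisfies `𝟏 × f(-t) = 1`, where `𝟏` is the unit of the
juxtaproduct. -/
def IsF (f : SClass n 𝒢 R) : Prop :=
  cross 1 (fun k => (-1 : R) ^ k • f k) = crossOne

/-- The family `c = (c_k)` (with `c₀ = 0`) satisfies `∑_{k ≥ 1} c_k t^{k-1} = d/dt ln 𝟏`, in the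
form `𝟏 × ∑ c_k t^k = t · d/dt 𝟏`, which makes sense over every ring `R`. -/
def IsC (c : SClass n 𝒢 R) : Prop :=
  c 0 = 0 ∧ cross 1 c = fun k : ℕ => k • (1 : NClass n (Wreath (Fin k) 𝒢) R)

end SClass

/-! ### Principal bundles for a discrete groupoid, and `𝒢`-covers -/

/-- A principal bundle over `Y` for the (discrete) groupoid `𝒢`. The total space `P` with its
anchor map to the discrete set of objects of `𝒢` and its `𝒢`-action is recorded as a functor: the
fibre `tot.obj x` of the anchor map is an open and closed piece of `P`, and an arrow `g : x ⟶ y`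
acts by `tot.map g : tot.obj x → tot.obj y`. The projection to `Y` is invariant, étale and
surjective, and `𝒢` acts freely and transitively on its fibres. (As `𝒢` is discrete, this
amounts to local triviality.) -/
structure PrinBundle (𝒢 : Type u) [Groupoid.{u} 𝒢] (Y : Type u) [TopologicalSpace Y] where
  tot : 𝒢 ⥤ TopCat.{u}
  proj : ∀ x, tot.obj x → Y
  proj_map : ∀ {x y : 𝒢} (g : x ⟶ y) (p : tot.obj x), proj y (tot.map g p) = proj x p
  isLocalHomeomorph_proj : ∀ x, IsLocalHomeomorph (proj x)
  exists_proj_eq : ∀ b : Y, ∃ x, ∃ p : tot.obj x, proj x p = b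
  existsUnique_map_eq : ∀ {x y : 𝒢} (p : tot.obj x) (q : tot.obj y), proj x p = proj y q →
    ∃! g : x ⟶ y, tot.map g p = q

/-- The restriction of a principal bundle to an open subset of the base. -/
def PrinBundle.restrict {𝒢 : Type u} [Groupoid.{u} 𝒢] {Y : Type u} [TopologicalSpace Y]
    (P : PrinBundle 𝒢 Y) (U : TopologicalSpace.Opens Y) : PrinBundle 𝒢 U where
  tot :=
    { obj x := TopCat.of {p : P.tot.obj x // P.proj x p ∈ U}
      map g := TopCat.ofHom
        ⟨fun p => ⟨P.tot.map g p.1, by rw [P.proj_map]; exact p.2⟩, by fun_prop⟩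
      map_id x := by ext p; simp
      map_comp f g := by ext p; simp }
  proj x p := ⟨P.proj x p.1, p.2⟩
  proj_map g p := Subtype.ext (P.proj_map g p.1)
  isLocalHomeomorph_proj x := by
    have h := P.isLocalHomeomorph_proj x
    refine IsLocalHomeomorph.of_comp (g := (Subtype.val : U → Y)) ?_ ?_ ?_
    · have hV : IsOpen {p : P.tot.obj x | P.proj x p ∈ U} := U.isOpen.preimage h.continuous
      exact h.comp hV.isOpenEmbedding_subtypeVal.isLocalHomeomorph
    · exact U.isOpenEmbedding'.isLocalHomeomorph
    · exact (h.continuous.comp continuous_subtype_val).subtype_mk _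
  exists_proj_eq b := by
    obtain ⟨x, p, hp⟩ := P.exists_proj_eq b
    exact ⟨x, ⟨p, hp ▸ b.2⟩, Subtype.ext hp⟩
  existsUnique_map_eq p q h := by
    obtain ⟨g, hg, hg'⟩ := P.existsUnique_map_eq p.1 q.1 (congrArg Subtype.val h)
    exact ⟨g, Subtype.ext hg, fun g' h' => hg' g' (congrArg Subtype.val h')⟩

theorem isCoveringMap_restrict_isClopen {Y X : Type*} [TopologicalSpace Y] [TopologicalSpace X]
    {φ : Y → X} (hφ : IsCoveringMap φ) (hfin : ∀ x, (φ ⁻¹' {x}).Finite) {U : Set Y}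
    (hU : IsClopen U) : IsCoveringMap (fun y : U => φ y) := by
  intro x
  obtain ⟨hd, V, hxV, hV, -, H, hH⟩ := hφ x
  have : Finite (φ ⁻¹' {x}) := hfin x
  let s : V → φ ⁻¹' {x} → Y := fun v i => (H.symm (v, i)).1
  have hs : ∀ i, Continuous fun v => s v i := fun i => by fun_prop
  let W : Set V := ⋂ i, {v | s v i ∈ U ↔ s ⟨x, hxV⟩ i ∈ U}
  have hW : IsOpen W := by
    refine isOpen_iInter_of_finite fun i => ?_
    by_cases h : s ⟨x, hxV⟩ i ∈ U
    · simp only [h, iff_true]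
      exact hU.2.preimage (hs i)
    · simp only [h, iff_false]
      exact hU.compl.2.preimage (hs i)
  let W' : Set X := Subtype.val '' W
  have hW' : IsOpen W' := hV.isOpenMap_subtype_val _ hW
  let J := {i : φ ⁻¹' {x} // s ⟨x, hxV⟩ i ∈ U}
  have hφU : Continuous fun y : U => φ y := hφ.continuous.comp continuous_subtype_val
  have hsub : ∀ z, z ∈ W' → z ∈ V := by rintro _ ⟨v, -, rfl⟩; exact v.2
  have hmem : ∀ z (h : z ∈ W'), (⟨z, hsub z h⟩ : V) ∈ W := by
    rintro _ ⟨v, hv, rfl⟩; exact hv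
  refine IsEvenlyCovered.to_isEvenlyCovered_preimage (I := J)
    ⟨inferInstance, W', ⟨⟨x, hxV⟩, by simp [W], rfl⟩, hW', hW'.preimage hφU, ?_⟩
  have hHs : ∀ z : φ ⁻¹' V, s (H z).1 (H z).2 = z := fun z => by simp [s]
  have hφs : ∀ v i, φ (s v i) = v := fun v i => by
    rw [← hH]; simp
  let toV : (fun y : U => φ y) ⁻¹' W' → φ ⁻¹' V := fun z => ⟨z.1.1, hsub _ z.2⟩
  have htoV : Continuous toV := by fun_prop
  have hHV : ∀ z, (H (toV z)).1 = ⟨φ z.1.1, hsub _ z.2⟩ := fun z => Subtype.ext (hH _)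
  refine ⟨⟨⟨fun z => (⟨φ z.1.1, z.2⟩, ⟨(H (toV z)).2, ?_⟩),
    fun q => ⟨⟨s ⟨q.1.1, hsub _ q.1.2⟩ q.2.1, ?_⟩, ?_⟩, fun z => ?_, fun q => ?_⟩, ?_, ?_⟩,
    fun z => rfl⟩
  · have h1 := Set.mem_iInter.1 (hmem _ z.2) (H (toV z)).2
    refine h1.1 ?_
    rw [← hHV, hHs]
    exact z.1.2
  · exact (Set.mem_iInter.1 (hmem _ q.1.2) q.2.1).2 q.2.2
  · change φ (s _ _) ∈ W'
    rw [hφs]; exact q.1.2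
  · refine Subtype.ext (Subtype.ext ?_)
    change s _ (H (toV z)).2 = _
    rw [← hHV, hHs]
  · refine Prod.ext (Subtype.ext (hφs _ _)) (Subtype.ext ?_)
    change (H ⟨(H.symm _).1, _⟩).2 = _
    simp
  · have h2 : Continuous fun z => (H (toV z)).2 := by fun_prop
    have h1 : Continuous fun z : (fun y : U => φ y) ⁻¹' W' => φ z.1.1 := by
      exact hφU.comp continuous_subtype_val
    exact (h1.subtype_mk _).prodMk (h2.subtype_mk _)
  · have h1 : Continuous fun q : W' × J => (⟨q.1.1, hsub _ q.1.2⟩ : V) :=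
      (continuous_subtype_val.comp continuous_fst).subtype_mk _
    have h2 : Continuous fun q : W' × J => q.2.1 := continuous_subtype_val.comp continuous_snd
    have h3 := continuous_subtype_val.comp (H.symm.continuous.comp (h1.prodMk h2))
    exact (h3.subtype_mk _).subtype_mk _

/-- A `𝒢`-cover `P → Y → X` of `X` of finite degree: a finite cover `cov : Y → X` together with a
principal `𝒢`-bundle over `Y`. -/
structure GCov (𝒢 : Type u) [Groupoid.{u} 𝒢] (X : Type*) [TopologicalSpace X] where
  base : Type u
  [top : TopologicalSpace base]
  cov : base → X
  isCoveringMap_cov : IsCoveringMap cov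
  finite_fibre : ∀ x, (cov ⁻¹' {x}).Finite
  bundle : PrinBundle 𝒢 base

namespace GCov

attribute [instance] GCov.top

variable {𝒢 : Type u} [Groupoid.{u} 𝒢] {X : Type*} [TopologicalSpace X]

/-- Morphisms of `𝒢`-covers: `𝒢`-equivariant homeomorphisms `P ≅ P'` over `X`. -/
@[ext]
structure Hom (P Q : GCov 𝒢 X) where
  iso : P.bundle.tot ≅ Q.bundle.tot
  comm : ∀ x (p : P.bundle.tot.obj x),
    Q.cov (Q.bundle.proj x (iso.hom.app x p)) = P.cov (P.bundle.proj x p)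

instance : Groupoid (GCov 𝒢 X) where
  Hom := Hom
  id P := ⟨Iso.refl _, fun _ _ => rfl⟩
  comp f g := ⟨f.iso ≪≫ g.iso, fun x p => (g.comm x _).trans (f.comm x p)⟩
  inv f := ⟨f.iso.symm, fun x p => by
    rw [← f.comm]
    simp⟩
  id_comp f := Hom.ext (Iso.refl_trans _)
  comp_id f := Hom.ext (Iso.trans_refl _)
  assoc f g h := Hom.ext (Iso.trans_assoc _ _ _)
  inv_comp f := Hom.ext (Iso.symm_self_id _)
  comp_inv f := Hom.ext (Iso.self_symm_id _)

/-- The finite cover `Y → X` is a `k`-fold cover. -/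
def IsKFold (P : GCov 𝒢 X) (k : ℕ) : Prop := ∀ x, (P.cov ⁻¹' {x}).ncard = k

/-- The restriction of a `𝒢`-cover to an open and closed subset of `Y`. -/
def restrict (P : GCov 𝒢 X) (U : TopologicalSpace.Clopens P.base) : GCov 𝒢 X where
  base := U.toOpens
  cov y := P.cov y
  isCoveringMap_cov := isCoveringMap_restrict_isClopen P.isCoveringMap_cov P.finite_fibre U.isClopen
  finite_fibre x := by
    have := (P.finite_fibre x).preimage (f := (Subtype.val : U.toOpens → P.base))
      Subtype.val_injective.injOn
    exact this
  bundle := P.bundle.restrict U.toOpens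

end GCov

/-! ### The torus and holonomy -/

/-- The `n`-torus. -/
abbrev Torus (n : ℕ) : Type := Fin n → Circle

/-- The `j`-th standard loop in the `n`-torus, based at `1`. -/
noncomputable def Torus.loop {n : ℕ} (j : Fin n) (t : unitInterval) : Torus n :=
  Pi.mulSingle j (Circle.exp (2 * Real.pi * t))

/-- The `𝒢`-cover `P → Y → Tⁿ` has holonomy given by the object `((xᵢ), (σ_j, g_j))` of
`𝓘ⁿ(S_k ≀ 𝒢)`: there are points `pᵢ` of `P` above the base point `1`, with anchor `xᵢ`, whose
images number the fibre of `Y` at `1`, and such that the lift to `P` of the `j`-th standard loop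
starting at `pᵢ` ends at the point that `g_{j,i} : xᵢ ⟶ x_{σ_j(i)}` sends to `p_{σ_j(i)}`. -/
def GCov.HasHolonomy {n k : ℕ} {𝒢 : Type u} [Groupoid.{u} 𝒢] (P : GCov 𝒢 (Torus n))
    (x : Inertia n (Wreath (Fin k) 𝒢)) : Prop :=
  ∃ p : ∀ i : Fin k, P.bundle.tot.obj (x.pt.pt i),
    Set.BijOn (fun i => P.bundle.proj _ (p i)) Set.univ (P.cov ⁻¹' {1}) ∧
    ∀ (j : Fin n) (i : Fin k), ∃ γ : unitInterval → P.bundle.tot.obj (x.pt.pt i),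
      Continuous γ ∧ γ 0 = p i ∧ (∀ t, P.cov (P.bundle.proj _ (γ t)) = Torus.loop j t) ∧
        P.bundle.tot.map ((x.aut j).arr i ((x.aut j).perm i) rfl) (γ 1) = p ((x.aut j).perm i)

/-! The equivalence is covering space theory for the torus. A finite cover of `Tⁿ` is a finite
`ℤⁿ`-set, namely its fibre at `1`. For a `𝒢`-cover, the points of `P` over `1` with anchor `y` form
a `ℤⁿ`-set functorial in `y`. If points `pᵢ` with anchors `xᵢ` number the fibre of `Y`, freeness and
transitivity make this set the set of pairs of an index `i` and an arrow `xᵢ ⟶ y`. By a Yoneda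
argument, bijections of such families that are natural in `y` are exactly the arrows of `S_k ≀ 𝒢`,
so a commuting family of `n` of them is an object of `𝓘ⁿ(S_k ≀ 𝒢)`. Conversely, the quotient of
(fibre) `× ℝⁿ` by `ℤⁿ` (`Tw`, `Inertia.cover`) realizes any holonomy. Uniqueness of lifts from `ℝⁿ`
gives fullness, and lifting `ℝⁿ → Tⁿ` to `P` gives essential surjectivity (`Frame.exists_hom`).

For the cross product, a transfer is a sum over the homotopy fibre when this is discrete
(`InvFun.transfer_eq_sum`). The homotopy fibre of concatenation over `x` is the set of subsets of
the indices that are stable under the permutations of `x` (`restrConcat_bijective`). As `ℝⁿ` is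
connected, these are the open and closed subsets of `Y`, which gives the sum over decompositions
(`equivInvFun_cross`).

Finally, `Y` has finitely many components and its open and closed subsets are the sets of
components, so the cross product is the product of set functions familiar from the exponential
formula. In particular `𝟏 × s` sums `s` over all sets of components. This operation is triangular
with unit diagonal, hence injective, which gives the uniqueness of `c` and `f`. Existence is
additivity of the degree for `c`, and the vanishing of alternating sums over subsets for `f`. On
functions of the number of components alone, the cross product multiplies exponential generating
functions: `𝟏` becomes `e^X`, and its logarithm `X`, the indicator of connected covers. -/

/-! ### Transfers as sums over homotopy fibres. -/

theorem Nat.card_aut_eq_card_hom {C : Type*} [Groupoid C] (x : C) :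
    Nat.card (Aut x) = Nat.card (x ⟶ x) :=
  Nat.card_congr (Groupoid.isoEquivHom x x)

/-- If the homotopy fibre of `F` over `y` is discrete and represented by the objects `z t`, then the
transfer along `F` is the sum over this homotopy fibre. -/
theorem InvFun.transfer_eq_sum {C D : Type*} [Groupoid C] [Groupoid D] {R : Type*} [CommRing R]
    (F : C ⥤ D) (f : InvFun C R) (y : D) [Finite (y ⟶ y)] [∀ c : C, Finite (c ⟶ c)]
    {T : Type*} [Fintype T] (z : T → C) (e : ∀ t, F.obj (z t) ⟶ y)
    (h : ∀ c, Function.Bijective fun p : Σ t, (c ⟶ z t) => F.map p.2 ≫ e p.1) :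
    InvFun.transfer F f y = ∑ t, f (z t) := by
  classical
  let cl : T → Quotient (isIsomorphicSetoid C) := fun t => ⟦z t⟧
  have key : ∀ q : Quotient (isIsomorphicSetoid C),
      (if Nonempty (F.obj q.out ≅ y) then
        ((Nat.card (Aut y) / Nat.card (Aut q.out) : ℕ) : R) * f q.out else 0) =
      ∑ t with cl t = q, f (z t) := by
    intro q
    have hiso : ∀ t, cl t = q ↔ Nonempty (q.out ⟶ z t) := by
      intro t
      constructor
      · rintro rfl
        obtain ⟨i⟩ := Quotient.exact (Quotient.out_eq (cl t))
        exact ⟨i.hom⟩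
      · rintro ⟨i⟩
        rw [← Quotient.out_eq q]
        exact Quotient.sound ⟨((Groupoid.isoEquivHom _ _).symm i).symm⟩
    have hsum : ∑ t with cl t = q, f (z t) =
        ((Finset.univ.filter fun t => cl t = q).card : ℕ) * f q.out := by
      rw [← nsmul_eq_mul, ← Finset.sum_const]
      refine Finset.sum_congr rfl fun t ht => ?_
      obtain ⟨i⟩ := (hiso t).1 (Finset.mem_filter.1 ht).2
      exact f.2 _ _ ⟨((Groupoid.isoEquivHom _ _).symm i).symm⟩
    rw [hsum]
    have hcard : ∀ t, Nat.card (q.out ⟶ z t) = if cl t = q then Nat.card (Aut q.out) else 0 := by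
      intro t
      split_ifs with ht
      · obtain ⟨i⟩ := (hiso t).1 ht
        rw [Nat.card_aut_eq_card_hom]
        exact Nat.card_congr ⟨fun g => g ≫ Groupoid.inv i, fun g => g ≫ i, fun g => by simp,
          fun g => by simp⟩
      · rw [hiso, not_nonempty_iff] at ht
        exact Nat.card_of_isEmpty
    have hfin : ∀ t, Finite (q.out ⟶ z t) := by
      intro t
      by_cases ht : Nonempty (q.out ⟶ z t)
      · obtain ⟨i⟩ := ht
        exact Finite.of_injective (fun g : q.out ⟶ z t => g ≫ Groupoid.inv i)
          fun g g' hg => by simpa using hg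
      · rw [not_nonempty_iff] at ht
        infer_instance
    -- Count both sides of the bijection `h` at the representative of `q`: each `z t` in the class
    -- contributes a torsor under its automorphism group. Thus the quotient of orders in the
    -- transfer is the number of such `t`.
    have htot : Nat.card (F.obj q.out ⟶ y) =
        (Finset.univ.filter fun t => cl t = q).card * Nat.card (Aut q.out) := by
      rw [← Nat.card_congr (Equiv.ofBijective _ (h q.out)), Nat.card_sigma]
      simp_rw [hcard]
      rw [← Finset.sum_filter, Finset.sum_const, smul_eq_mul]
    have hpos : 0 < Nat.card (Aut q.out) := by
      rw [Nat.card_aut_eq_card_hom]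
      have : Nonempty (q.out ⟶ q.out) := ⟨𝟙 _⟩
      exact Nat.card_pos
    split_ifs with hne
    · obtain ⟨i⟩ := hne
      have : Nat.card (Aut y) = Nat.card (F.obj q.out ⟶ y) := by
        rw [Nat.card_aut_eq_card_hom]
        exact Nat.card_congr ⟨fun g => i.hom ≫ g, fun g => i.inv ≫ g, fun g => by simp,
          fun g => by simp⟩
      rw [this, htot, Nat.mul_div_cancel _ hpos]
    -- Off the class of `y` the count is zero, so no `z t` lies in the class `q`.
    · have : IsEmpty (F.obj q.out ⟶ y) := ⟨fun i => hne ⟨(Groupoid.isoEquivHom _ _).symm i⟩⟩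
      rw [Nat.card_of_isEmpty] at htot
      rcases Nat.mul_eq_zero.1 htot.symm with h0 | h0
      · simp [h0]
      · omega
  change ∑ᶠ q : Quotient (isIsomorphicSetoid C), _ = _
  rw [finsum_congr key, finsum_eq_sum_of_support_subset (s := Finset.univ.image cl)]
  · exact Finset.sum_fiberwise_of_maps_to
      (fun t _ => Finset.mem_image_of_mem _ (Finset.mem_univ t)) _
  · intro q hq
    obtain ⟨t, ht, -⟩ := Finset.exists_ne_zero_of_sum_ne_zero hq
    simp only [Finset.mem_filter] at ht
    simp [← ht.2]

/-! ### Arrows out of a concatenation. -/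

namespace Wreath

variable {I J K : Type*} {𝒢 : Type*} [Groupoid 𝒢]

theorem comp_perm {x y z : Wreath I 𝒢} (f : x ⟶ y) (g : y ⟶ z) (i : I) :
    (f ≫ g).perm i = g.perm (f.perm i) := rfl

theorem comp_arr {x y z : Wreath I 𝒢} (f : x ⟶ y) (g : y ⟶ z) {i l : I} (m : I)
    (hm : f.perm i = m) (hl : g.perm m = l) (h : (f ≫ g).perm i = l) :
    (f ≫ g).arr i l h = f.arr i m hm ≫ g.arr m l hl := by
  subst hm
  rfl

theorem Hom.arr_congr {x y : Wreath I 𝒢} (f : Hom x y) {i i' l : I} (hi : i = i')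
    (h : f.perm i = l) (h' : f.perm i' = l) :
    f.arr i l h = eqToHom (congrArg x.pt hi) ≫ f.arr i' l h' := by
  subst hi
  simp

theorem hom_congr_arr {x y : Wreath I 𝒢} {f g : x ⟶ y} (h : f = g) {i l : I}
    (hf : f.perm i = l) (hg : g.perm i = l) : f.arr i l hf = g.arr i l hg := by
  subst h
  rfl

instance finiteHom [Finite I] [∀ x y : 𝒢, Finite (x ⟶ y)] (x y : Wreath I 𝒢) :
    Finite (x ⟶ y) := by
  let F : (x ⟶ y) → Equiv.Perm I × (∀ i j, Option (x.pt i ⟶ y.pt j)) := by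
    classical
    exact fun f => (f.perm, fun i j => if h : f.perm i = j then some (f.arr i j h) else none)
  refine Finite.of_injective F fun f g h => ?_
  refine Hom.ext' (fun i => DFunLike.congr_fun (congrArg Prod.fst h) i) fun i j hf hg => ?_
  have := congrFun (congrFun (congrArg Prod.snd h) i) j
  simpa [F, hf, hg] using this

/-- An arrow out of a concatenation, described by arrows out of the two pieces. -/
def concatHom (ε : I ⊕ J ≃ K) {z : Wreath I 𝒢 × Wreath J 𝒢} {y : Wreath K 𝒢} (π : I ⊕ J ≃ K)
    (a : ∀ s l, π s = l → (Sum.elim z.1.pt z.2.pt s ⟶ y.pt l)) : (concat ε).obj z ⟶ y :=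
  Hom.mk (ε.symm.trans π) fun k l h => a (ε.symm k) l h

/-- Objects of a concatenation are indexed through `ε.symm`, which would put casts everywhere. This
normal form indexes arrows by `I ⊕ J` itself and confines the cast to one `eqToHom`. -/
theorem exists_eq_concatHom (ε : I ⊕ J ≃ K) {z : Wreath I 𝒢 × Wreath J 𝒢} {y : Wreath K 𝒢}
    (e : (concat ε).obj z ⟶ y) : ∃ (π : I ⊕ J ≃ K)
      (a : ∀ s l, π s = l → (Sum.elim z.1.pt z.2.pt s ⟶ y.pt l)), e = concatHom ε π a := by
  have hpt : ∀ s, Sum.elim z.1.pt z.2.pt s = ((concat ε).obj z).pt (ε s) := fun s => by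
    simp [concat]
  refine ⟨ε.trans e.perm, fun s l h => eqToHom (hpt s) ≫ Hom.arr e (ε s) l h, ?_⟩
  refine Hom.ext' (fun k => ?_) fun k l hf hg => ?_
  · simp [concatHom]
  · refine (Hom.arr_congr e (ε.apply_symm_apply k).symm hf (by simpa using hf)).trans ?_
    rfl

/-- Reduces commutation with automorphisms to conditions on the two blocks. It serves both to build
arrows of inertia groupoids and to read off that the image of a block is stable. The free indices
`t`, `m`, `l` with their equations avoid transport along equalities of indices. -/
theorem concatHom_conj (ε : I ⊕ J ≃ K) {z z' : Wreath I 𝒢 × Wreath J 𝒢} {y y' : Wreath K 𝒢}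
    (π π' : I ⊕ J ≃ K) (a : ∀ s l, π s = l → (Sum.elim z.1.pt z.2.pt s ⟶ y.pt l))
    (a' : ∀ s l, π' s = l → (Sum.elim z'.1.pt z'.2.pt s ⟶ y'.pt l)) (f : z ⟶ z') (g : y ⟶ y') :
    (concat ε).map f ≫ concatHom ε π' a' = concatHom ε π a ≫ g ↔
      (∀ s, π' (Equiv.sumCongr f.1.perm f.2.perm s) = g.perm (π s)) ∧
        ∀ s t m l (ht : Equiv.sumCongr f.1.perm f.2.perm s = t) (hl : π' t = l) (hm : π s = m)
          (hl' : g.perm m = l), sumArr f s t ht ≫ a' t l hl = a s m hm ≫ g.arr m l hl' := by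
  have arr_left : ∀ k t l (ht : Equiv.sumCongr f.1.perm f.2.perm (ε.symm k) = t) (hl : π' t = l) h,
      ((concat ε).map f ≫ concatHom ε π' a').arr k l h = sumArr f (ε.symm k) t ht ≫ a' t l hl := by
    intro k t l ht hl h
    obtain ⟨k', rfl⟩ := ε.symm.surjective t
    exact comp_arr ((concat ε).map f) (concatHom ε π' a') k' (by simp [concat, ht]) hl h
  have arr_right : ∀ k m l (hm : π (ε.symm k) = m) (hl : g.perm m = l) h,
      (concatHom ε π a ≫ g).arr k l h = a (ε.symm k) m hm ≫ g.arr m l hl :=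
    fun k m l hm hl h => comp_arr (concatHom ε π a) g m hm hl h
  constructor
  · intro h
    refine ⟨fun s => ?_, fun s t m l ht hl hm hl' => ?_⟩
    · have := congrArg (fun u => Hom.perm u (ε s)) h
      simpa [comp_perm, concatHom, concat] using this
    · obtain ⟨k, rfl⟩ := ε.symm.surjective s
      have hk : (concatHom ε π a ≫ g).perm k = l := by
        rw [comp_perm, ← hl', ← hm]; rfl
      rw [← arr_left k t l ht hl (by rw [h]; exact hk), ← arr_right k m l hm hl' hk]
      exact hom_congr_arr h _ _
  · rintro ⟨hp, ha⟩
    refine Hom.ext' (fun k => ?_) fun k l hf hg => ?_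
    · simp [comp_perm, concatHom, concat, ← hp]
    · have hl : g.perm (π (ε.symm k)) = l := hg
      refine (arr_left k _ l rfl ((hp _).trans hl) hf).trans
        (Eq.trans ?_ (arr_right k _ l rfl hl hg).symm)
      exact ha _ _ _ _ _ _ _ _

theorem concat_map_comp_concatHom (ε : I ⊕ J ≃ K) {z z' : Wreath I 𝒢 × Wreath J 𝒢}
    {y : Wreath K 𝒢} (π π' : I ⊕ J ≃ K)
    (a : ∀ s l, π s = l → (Sum.elim z.1.pt z.2.pt s ⟶ y.pt l))
    (a' : ∀ s l, π' s = l → (Sum.elim z'.1.pt z'.2.pt s ⟶ y.pt l)) (f : z ⟶ z')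
    (hp : ∀ s, π' (Equiv.sumCongr f.1.perm f.2.perm s) = π s)
    (ha : ∀ s t l (ht : Equiv.sumCongr f.1.perm f.2.perm s = t) (hl : π' t = l) (hl' : π s = l),
      sumArr f s t ht ≫ a' t l hl = a s l hl') :
    (concat ε).map f ≫ concatHom ε π' a' = concatHom ε π a := by
  rw [← Category.comp_id (concatHom ε π a)]
  refine (concatHom_conj ε π π' a a' f (𝟙 y)).2 ⟨hp, fun s t m l ht hl hm hl' => ?_⟩
  obtain rfl : m = l := hl'
  rw [ha s t m ht hl hm]
  exact (Category.comp_id _).symm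

theorem concat_map_injective (ε : I ⊕ J ≃ K) {z z' : Wreath I 𝒢 × Wreath J 𝒢} :
    Function.Injective fun f : z ⟶ z' => (concat ε).map f := by
  intro f g h
  have hp : ∀ s, Equiv.sumCongr f.1.perm f.2.perm s = Equiv.sumCongr g.1.perm g.2.perm s := by
    intro s
    have := congrArg (fun u => ε.symm (Hom.perm u (ε s))) h
    simpa [concat] using this
  have ha : ∀ s t (hf : Equiv.sumCongr f.1.perm f.2.perm s = t)
      (hg : Equiv.sumCongr g.1.perm g.2.perm s = t), sumArr f s t hf = sumArr g s t hg := by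
    intro s t hf hg
    obtain ⟨k, rfl⟩ := ε.symm.surjective s
    obtain ⟨l, rfl⟩ := ε.symm.surjective t
    exact hom_congr_arr h (i := k) (l := l) (by simp [concat, hf]) (by simp [concat, hg])
  refine Prod.ext (Hom.ext' (fun i => ?_) fun i j hf hg => ?_)
    (Hom.ext' (fun i => ?_) fun i j hf hg => ?_)
  · simpa using hp (.inl i)
  · exact ha (.inl i) (.inl j) (congrArg _ hf) (congrArg _ hg)
  · simpa using hp (.inr i)
  · exact ha (.inr i) (.inr j) (congrArg _ hf) (congrArg _ hg)

end Wreath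

/-! ### Stable sets of indices and the homotopy fibre of concatenation. -/

namespace Inertia

variable {n : ℕ} {C D : Type*} [Groupoid C] [Groupoid D]

theorem comp_arr {x y z : Inertia n C} (f : x ⟶ y) (g : y ⟶ z) : (f ≫ g).arr = f.arr ≫ g.arr := rfl

instance finiteHom [∀ x y : C, Finite (x ⟶ y)] (x y : Inertia n C) : Finite (x ⟶ y) :=
  Finite.of_injective (fun f : x ⟶ y => f.arr) fun _ _ h => Hom.ext h

/-- A pair of objects of inertia groupoids as an object of the inertia groupoid of the product. -/
def pair (x : Inertia n C) (y : Inertia n D) : Inertia n (C × D) where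
  pt := (x.pt, y.pt)
  aut j := (x.aut j, y.aut j)
  comm i j := Prod.ext (x.comm i j) (y.comm i j)

variable {I K : Type*} {𝒢 : Type*} [Groupoid 𝒢]

/-- The restriction of an object of `𝓘ⁿ(S_K ≀ 𝒢)` along an injective map `α : I → K` whose image is
stable under the permutations. -/
noncomputable def sub [Finite I] (x : Inertia n (Wreath K 𝒢)) (α : I → K) (hα : α.Injective)
    (hst : ∀ j i, ∃ i', α i' = (x.aut j).perm (α i)) : Inertia n (Wreath I 𝒢) where
  pt := ⟨fun i => x.pt.pt (α i)⟩
  aut j := Wreath.Hom.mk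
    (Equiv.ofBijective (fun i => (hst j i).choose) <| Finite.injective_iff_bijective.1 fun i i' h =>
      hα <| (x.aut j).perm.injective <| by
        rw [← (hst j i).choose_spec, ← (hst j i').choose_spec]; exact congrArg α h)
    fun i l h => (x.aut j).arr (α i) (α l) (by
      rw [← h]; exact (hst j i).choose_spec.symm)
  comm j j' := by
    refine Wreath.Hom.ext' (fun i => hα ?_) fun i l hf hg => ?_
    · change α (hst j' _).choose = α (hst j _).choose
      rw [(hst j' _).choose_spec, (hst j _).choose_spec]
      change (x.aut j').perm (α (hst j i).choose) = (x.aut j).perm (α (hst j' i).choose)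
      rw [(hst j i).choose_spec, (hst j' i).choose_spec, ← Wreath.comp_perm, ← Wreath.comp_perm,
        x.comm]
    · have h1 : (x.aut j).perm (α i) = α (hst j i).choose := (hst j i).choose_spec.symm
      have h2 : (x.aut j').perm (α i) = α (hst j' i).choose := (hst j' i).choose_spec.symm
      have h3 : (x.aut j').perm (α (hst j i).choose) = α l := by
        rw [← hf]; exact (hst j' _).choose_spec.symm
      have h4 : (x.aut j).perm (α (hst j' i).choose) = α l := by
        rw [← hg]; exact (hst j _).choose_spec.symm
      have hc := Wreath.hom_congr_arr (x.comm j j') (i := α i) (l := α l)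
        (by rw [Wreath.comp_perm, h1, h3]) (by rw [Wreath.comp_perm, h2, h4])
      rw [Wreath.comp_arr _ _ _ h1 h3, Wreath.comp_arr _ _ _ h2 h4] at hc
      exact hc

theorem sub_perm [Finite I] (x : Inertia n (Wreath K 𝒢)) (α : I → K) (hα : α.Injective)
    (hst : ∀ j i, ∃ i', α i' = (x.aut j).perm (α i)) (j : Fin n) (i : I) :
    α (((x.sub α hα hst).aut j).perm i) = (x.aut j).perm (α i) :=
  (hst j i).choose_spec

/-- A set of indices that is stable under the permutations in `x`. -/
def Stable (x : Inertia n (Wreath K 𝒢)) (S : Finset K) : Prop :=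
  ∀ j i, (x.aut j).perm i ∈ S ↔ i ∈ S

theorem Stable.compl [Fintype K] [DecidableEq K] {x : Inertia n (Wreath K 𝒢)} {S : Finset K}
    (h : x.Stable S) : x.Stable Sᶜ := fun j i => by simp [h j i]

section Fin

variable {k : ℕ} (x : Inertia n (Wreath (Fin k) 𝒢))

theorem Stable.exists_orderEmb {x : Inertia n (Wreath (Fin k) 𝒢)} {S : Finset (Fin k)}
    (h : x.Stable S) {a : ℕ} (ha : S.card = a) (j : Fin n) (i : Fin a) :
    ∃ i', S.orderEmbOfFin ha i' = (x.aut j).perm (S.orderEmbOfFin ha i) := by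
  rw [← Set.mem_range, Finset.range_orderEmbOfFin, Finset.mem_coe, h]
  exact Finset.orderEmbOfFin_mem S ha i

/-- The restriction of `x` to a stable set of indices. -/
noncomputable def restr (S : Finset (Fin k)) (h : x.Stable S) {a : ℕ} (ha : S.card = a) :
    Inertia n (Wreath (Fin a) 𝒢) :=
  x.sub (S.orderEmbOfFin ha) (S.orderEmbOfFin ha).injective (h.exists_orderEmb ha)

theorem restr_perm (S : Finset (Fin k)) (h : x.Stable S) {a : ℕ} (ha : S.card = a) (j : Fin n)
    (i : Fin a) : S.orderEmbOfFin ha (((x.restr S h ha).aut j).perm i) =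
      (x.aut j).perm (S.orderEmbOfFin ha i) :=
  sub_perm x _ _ (h.exists_orderEmb ha) j i

theorem card_compl_eq {a b : ℕ} (hab : a + b = k) {S : Finset (Fin k)} (ha : S.card = a) :
    Sᶜ.card = b := by
  rw [Finset.card_compl, Fintype.card_fin, ha]; omega

variable {a b : ℕ} (ε : Fin a ⊕ Fin b ≃ Fin k)

/-- The components of the isomorphism between the concatenation of two restrictions of `x` and
`x`. -/
noncomputable def restrArr (S : Finset (Fin k)) (h : x.Stable S) (ha : S.card = a)
    (hb : Sᶜ.card = b) :
    ∀ s l, finSumEquivOfFinset ha hb s = l → (Sum.elim (x.restr S h ha).pt.pt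
      (x.restr Sᶜ h.compl hb).pt.pt s ⟶ x.pt.pt l)
  | .inl _, _, e => eqToHom (congrArg x.pt.pt ((finSumEquivOfFinset_inl _ _ _).symm.trans e))
  | .inr _, _, e => eqToHom (congrArg x.pt.pt ((finSumEquivOfFinset_inr _ _ _).symm.trans e))

/-- `x` is the concatenation of its restrictions to a stable set and to the complement. -/
noncomputable def restrConcat (S : Finset (Fin k)) (h : x.Stable S) (ha : S.card = a)
    (hb : Sᶜ.card = b) :
    (Inertia.map n (Wreath.concat ε)).obj (pair (x.restr S h ha) (x.restr Sᶜ h.compl hb)) ⟶ x :=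
  Hom.mk (Wreath.concatHom ε (finSumEquivOfFinset ha hb) (x.restrArr S h ha hb)) <| by
  intro j
  have hp : ∀ s, finSumEquivOfFinset ha hb (Equiv.sumCongr ((x.restr S h ha).aut j).perm
      ((x.restr Sᶜ h.compl hb).aut j).perm s) =
      (x.aut j).perm (finSumEquivOfFinset ha hb s) := by
    rintro (i | i)
    · simpa using x.restr_perm S h ha j i
    · simpa using x.restr_perm Sᶜ h.compl hb j i
  refine (Wreath.concatHom_conj ε _ _ _ _ _ _).2 ⟨hp, ?_⟩
  have key : ∀ (i i' l l' : Fin k) (h1 : (x.aut j).perm i = l) (h2 : l = l') (h3 : i = i')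
      (h4 : (x.aut j).perm i' = l'), (x.aut j).arr i l h1 ≫ eqToHom (congrArg x.pt.pt h2) =
      eqToHom (congrArg x.pt.pt h3) ≫ (x.aut j).arr i' l' h4 := by
    rintro i i' l l' h1 rfl rfl h4
    simp
  rintro (i | i)
  · intro t m l ht hl hm hl'
    obtain rfl := ht
    exact key _ _ _ _ _ ((finSumEquivOfFinset_inl _ _ _).symm.trans hl)
      ((finSumEquivOfFinset_inl _ _ _).symm.trans hm) hl'
  · intro t m l ht hl hm hl'
    obtain rfl := ht
    exact key _ _ _ _ _ ((finSumEquivOfFinset_inr _ _ _).symm.trans hl)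
      ((finSumEquivOfFinset_inr _ _ _).symm.trans hm) hl'

/-- The factorization needed for surjectivity below: once the bijection `π` splits along `S` and its
complement, the arrow factors through the standard one, with the components of `u` reindexed by the
increasing enumerations. -/
theorem concat_map_comp_restrArr (S : Finset (Fin k)) (h : x.Stable S) (ha : S.card = a)
    (hb : Sᶜ.card = b) {z : Wreath (Fin a) 𝒢 × Wreath (Fin b) 𝒢} (π : Fin a ⊕ Fin b ≃ Fin k)
    (u : ∀ s l, π s = l → (Sum.elim z.1.pt z.2.pt s ⟶ x.pt.pt l))
    (f₁ : z.1 ⟶ (x.restr S h ha).pt) (f₂ : z.2 ⟶ (x.restr Sᶜ h.compl hb).pt)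
    (hp : ∀ s, finSumEquivOfFinset ha hb (Equiv.sumCongr f₁.perm f₂.perm s) = π s)
    (h₁ : ∀ i l e e', f₁.arr i l e = u (.inl i) (S.orderEmbOfFin ha l) e')
    (h₂ : ∀ i l e e', f₂.arr i l e = u (.inr i) (Sᶜ.orderEmbOfFin hb l) e') :
    (Wreath.concat ε).map ((f₁, f₂) : z ⟶ ((x.restr S h ha).pt, (x.restr Sᶜ h.compl hb).pt)) ≫
      Wreath.concatHom ε (finSumEquivOfFinset ha hb) (x.restrArr S h ha hb) =
        Wreath.concatHom ε π u := by
  have key : ∀ s m l (hm : π s = m) (hl : m = l) (hl' : π s = l),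
      u s m hm ≫ eqToHom (congrArg x.pt.pt hl) = u s l hl' := by
    rintro s m l hm rfl hl'
    simp
  refine Wreath.concat_map_comp_concatHom (z := z)
    (z' := ((x.restr S h ha).pt, (x.restr Sᶜ h.compl hb).pt)) ε π (finSumEquivOfFinset ha hb) u
    (x.restrArr S h ha hb) ((f₁, f₂) : z ⟶ ((x.restr S h ha).pt, (x.restr Sᶜ h.compl hb).pt)) hp ?_
  rintro (i | i) t l ht hl hl'
  · obtain rfl := ht
    have e : π (.inl i) = S.orderEmbOfFin ha (f₁.perm i) := by
      rw [← hp]; exact finSumEquivOfFinset_inl _ _ _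
    refine Eq.trans ?_ (key (.inl i) _ l e (e.symm.trans hl') hl')
    rw [← h₁ i _ rfl e]
    rfl
  · obtain rfl := ht
    have e : π (.inr i) = Sᶜ.orderEmbOfFin hb (f₂.perm i) := by
      rw [← hp]; exact finSumEquivOfFinset_inr _ _ _
    refine Eq.trans ?_ (key (.inr i) _ l e (e.symm.trans hl') hl')
    rw [← h₂ i _ rfl e]
    rfl

/-- An arrow from a concatenation to `x` remembers the image `S` of the first block, which is stable
because the arrow commutes with the automorphisms. After `S` is fixed, the arrow is a pair of arrows
to the two restrictions of `x`. Hence the homotopy fibre is discrete, and this is the hypothesis of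
`InvFun.transfer_eq_sum`. -/
theorem restrConcat_bijective (hab : a + b = k)
    (z : Inertia n (Wreath (Fin a) 𝒢 × Wreath (Fin b) 𝒢)) :
    Function.Bijective fun p : Σ S : {S : Finset (Fin k) // x.Stable S ∧ S.card = a},
        (z ⟶ pair (x.restr S.1 S.2.1 S.2.2) (x.restr S.1ᶜ S.2.1.compl
          (card_compl_eq hab S.2.2))) =>
      (Inertia.map n (Wreath.concat ε)).map p.2 ≫ x.restrConcat ε p.1.1 p.1.2.1 p.1.2.2
        (card_compl_eq hab p.1.2.2) := by
  constructor
  · rintro ⟨⟨S, hS, ha⟩, f⟩ ⟨⟨S', hS', ha'⟩, f'⟩ h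
    have hb : Sᶜ.card = b := card_compl_eq hab ha
    have hb' : S'ᶜ.card = b := card_compl_eq hab ha'
    have hperm : ∀ i, S.orderEmbOfFin ha (f.arr.1.perm i) =
        S'.orderEmbOfFin ha' (f'.arr.1.perm i) := by
      intro i
      have h1 := congrArg (fun e => Wreath.Hom.perm (Inertia.Hom.arr e) (ε (.inl i))) h
      simpa [comp_arr, Wreath.comp_perm, restrConcat, Wreath.concatHom, Inertia.map,
        Wreath.concat] using h1
    -- Both sets are the image of the first block under the same bijection.
    obtain rfl : S = S' := by
      rw [← Finset.coe_inj, ← Finset.range_orderEmbOfFin S ha, ← Finset.range_orderEmbOfFin S' ha',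
        ← f.arr.1.perm.surjective.range_comp (S.orderEmbOfFin ha),
        ← f'.arr.1.perm.surjective.range_comp (S'.orderEmbOfFin ha')]
      exact congrArg Set.range (funext hperm)
    congr 1
    have h2 := (cancel_mono _).1 h
    exact Inertia.Hom.ext (Wreath.concat_map_injective ε (congrArg Inertia.Hom.arr h2))
  · intro e
    obtain ⟨π, u, he⟩ := Wreath.exists_eq_concatHom ε e.arr
    have hconj : ∀ j, _ := fun j => (Wreath.concatHom_conj ε π π u u (z.aut j) (x.aut j)).1
      (by rw [← he]; exact e.conj j)
    let S : Finset (Fin k) := Finset.univ.image fun i => π (.inl i)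
    have hinl : ∀ i, π (.inl i) ∈ S := fun i => Finset.mem_image_of_mem _ (Finset.mem_univ i)
    have hinr : ∀ i, π (.inr i) ∉ S := fun i => by simp [S]
    have ha : S.card = a := by
      exact (Finset.card_image_of_injective _ (π.injective.comp Sum.inl_injective)).trans (by simp)
    have hS : x.Stable S := by
      intro j l
      obtain ⟨s, rfl⟩ := π.surjective l
      obtain ⟨hp, -⟩ := hconj j
      rw [← hp]
      rcases s with i | i
      · simp [hinl]
      · simp [hinr]
    have hb : Sᶜ.card = b := card_compl_eq hab ha
    let ω := finSumEquivOfFinset ha hb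
    have hω : ∀ s, ω s ∈ S ↔ s.isLeft := by
      rintro (i | i)
      · simp only [ω, finSumEquivOfFinset_inl, Sum.isLeft_inl, iff_true]
        exact Finset.orderEmbOfFin_mem _ _ _
      · simp only [ω, finSumEquivOfFinset_inr, Sum.isLeft_inr, Bool.false_eq_true, iff_false,
          ← Finset.mem_compl]
        exact Finset.orderEmbOfFin_mem _ _ _
    -- Since `π` and the standard enumeration `ω` both send the first block onto `S`, they differ by
    -- a permutation preserving the blocks, that is, by a pair of permutations.
    obtain ⟨⟨p₁, p₂⟩, hp⟩ := Equiv.Perm.mem_sumCongrHom_range_of_perm_mapsTo_inl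
      (σ := π.trans ω.symm) (by
        rintro _ ⟨i, rfl⟩
        have h1 := hω (ω.symm (π (.inl i)))
        rw [ω.apply_symm_apply] at h1
        obtain ⟨i', hi'⟩ := Sum.isLeft_iff.1 (h1.1 (hinl i))
        exact ⟨i', hi'.symm⟩)
    have hp' : ∀ s, ω (Equiv.sumCongr p₁ p₂ s) = π s := fun s => by
      have h1 := DFunLike.congr_fun hp s
      rw [← ω.apply_symm_apply (π s)]
      exact congrArg ω h1
    let f₁ : z.pt.1 ⟶ (x.restr S hS ha).pt := Wreath.Hom.mk p₁ fun i l h =>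
      u (.inl i) (S.orderEmbOfFin ha l) (by rw [← hp', ← h]; simp [ω])
    let f₂ : z.pt.2 ⟶ (x.restr Sᶜ hS.compl hb).pt := Wreath.Hom.mk p₂ fun i l h =>
      u (.inr i) (Sᶜ.orderEmbOfFin hb l) (by rw [← hp', ← h]; simp [ω])
    have hf₁ : ∀ j, (z.aut j).1 ≫ f₁ = f₁ ≫ (x.restr S hS ha).aut j := by
      intro j
      obtain ⟨hq, hu⟩ := hconj j
      refine Wreath.Hom.ext' (fun i => (S.orderEmbOfFin ha).injective ?_) fun i l hf hg => ?_
      · have h1 := hq (.inl i)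
        rw [← hp', ← hp'] at h1
        refine Eq.trans ?_ (h1.trans ?_)
        · simp [ω, f₁, Wreath.comp_perm]
        · refine Eq.trans ?_ (x.restr_perm S hS ha j _).symm
          simp [ω, f₁]
      · rw [Wreath.comp_arr _ f₁ _ rfl hf, Wreath.comp_arr f₁ _ _ rfl hg]
        exact hu (.inl i) (.inl ((z.aut j).1.perm i)) _ _ rfl _ _ _
    have hf₂ : ∀ j, (z.aut j).2 ≫ f₂ = f₂ ≫ (x.restr Sᶜ hS.compl hb).aut j := by
      intro j
      obtain ⟨hq, hu⟩ := hconj j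
      refine Wreath.Hom.ext' (fun i => (Sᶜ.orderEmbOfFin hb).injective ?_) fun i l hf hg => ?_
      · have h1 := hq (.inr i)
        rw [← hp', ← hp'] at h1
        refine Eq.trans ?_ (h1.trans ?_)
        · simp [ω, f₂, Wreath.comp_perm]
        · refine Eq.trans ?_ (x.restr_perm Sᶜ hS.compl hb j _).symm
          simp [ω, f₂]
      · rw [Wreath.comp_arr _ f₂ _ rfl hf, Wreath.comp_arr f₂ _ _ rfl hg]
        exact hu (.inr i) (.inr ((z.aut j).2.perm i)) _ _ rfl _ _ _
    refine ⟨⟨⟨S, hS, ha⟩, ⟨(f₁, f₂), fun j => Prod.ext (hf₁ j) (hf₂ j)⟩⟩, ?_⟩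
    refine Inertia.Hom.ext ?_
    rw [he]
    exact x.concat_map_comp_restrArr ε S hS ha hb π u f₁ f₂ hp' (fun _ _ _ _ => rfl)
      fun _ _ _ _ => rfl

end Fin

end Inertia

/-! ### The cross product as a sum over stable sets. -/

namespace SClass

variable {n : ℕ} {𝒢 : Type*} [Groupoid 𝒢] {R : Type*} [CommRing R]

instance finiteProdHom {C D : Type*} [Groupoid C] [Groupoid D] [∀ x y : C, Finite (x ⟶ y)]
    [∀ x y : D, Finite (x ⟶ y)] (x y : C × D) : Finite (x ⟶ y) :=
  inferInstanceAs (Finite ((x.1 ⟶ y.1) × (x.2 ⟶ y.2)))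

open Classical in
theorem transfer_concat_apply [∀ x y : 𝒢, Finite (x ⟶ y)] {a b k : ℕ} (hab : a + b = k)
    (ε : Fin a ⊕ Fin b ≃ Fin k) (s : NClass n (Wreath (Fin a) 𝒢) R)
    (t : NClass n (Wreath (Fin b) 𝒢) R) (x : Inertia n (Wreath (Fin k) 𝒢)) :
    InvFun.transfer (Inertia.map n (Wreath.concat ε)) (kunneth s t) x =
      ∑ S : {S : Finset (Fin k) // x.Stable S ∧ S.card = a},
        s (x.restr S.1 S.2.1 S.2.2) *
          t (x.restr S.1ᶜ S.2.1.compl (Inertia.card_compl_eq hab S.2.2)) :=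
  InvFun.transfer_eq_sum (T := {S : Finset (Fin k) // x.Stable S ∧ S.card = a})
    (Inertia.map n (Wreath.concat ε)) (kunneth s t) x
    (fun S => Inertia.pair (x.restr S.1 S.2.1 S.2.2) (x.restr S.1ᶜ S.2.1.compl
      (Inertia.card_compl_eq hab S.2.2)))
    (fun S => x.restrConcat ε S.1 S.2.1 S.2.2 (Inertia.card_compl_eq hab S.2.2))
    (x.restrConcat_bijective ε hab)

open Classical in
/-- The cross product is the sum over the decompositions into two stable subsets. -/
theorem cross_apply [∀ x y : 𝒢, Finite (x ⟶ y)] (s t : SClass n 𝒢 R) (k : ℕ)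
    (x : Inertia n (Wreath (Fin k) 𝒢)) :
    cross s t k x = ∑ S : {S : Finset (Fin k) // x.Stable S},
      s S.1.card (x.restr S.1 S.2 rfl) * t S.1ᶜ.card (x.restr S.1ᶜ S.2.compl rfl) := by
  have h1 : cross s t k x = ∑ p : Finset.HasAntidiagonal.antidiagonal k,
      ∑ S : {S : Finset (Fin k) // x.Stable S ∧ S.card = p.1.1},
        s p.1.1 (x.restr S.1 S.2.1 S.2.2) * t p.1.2 (x.restr S.1ᶜ S.2.1.compl
          (Inertia.card_compl_eq (Finset.HasAntidiagonal.mem_antidiagonal.1 p.2) S.2.2)) := by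
    rw [cross, AddSubmonoidClass.coe_finsetSum, Finset.sum_apply]
    exact Finset.sum_congr rfl fun p _ =>
      transfer_concat_apply (Finset.HasAntidiagonal.mem_antidiagonal.1 p.2) _ _ _ _
  rw [h1]
  refine (Fintype.sum_sigma (fun q : Σ p : Finset.HasAntidiagonal.antidiagonal k,
      {S : Finset (Fin k) // x.Stable S ∧ S.card = p.1.1} =>
        s q.1.1.1 (x.restr q.2.1 q.2.2.1 q.2.2.2) * t q.1.1.2 (x.restr q.2.1ᶜ q.2.2.1.compl
          (Inertia.card_compl_eq (Finset.HasAntidiagonal.mem_antidiagonal.1 q.1.2)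
            q.2.2.2)))).symm.trans ?_
  -- The pair `(a, b)` is redundant: it consists of the sizes of `S` and its complement.
  refine Fintype.sum_bijective (fun q => ⟨q.2.1, q.2.2.1⟩) ⟨?_, ?_⟩ _ _ ?_
  · rintro ⟨⟨⟨a, b⟩, hab⟩, ⟨S, hS, ha⟩⟩ ⟨⟨⟨a', b'⟩, hab'⟩, ⟨S', hS', ha'⟩⟩ h
    obtain rfl : S = S' := congrArg Subtype.val h
    rw [Finset.HasAntidiagonal.mem_antidiagonal] at hab hab'
    dsimp only at ha ha' hab hab'
    obtain rfl : a = a' := ha.symm.trans ha'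
    obtain rfl : b = b' := by omega
    rfl
  · rintro ⟨S, hS⟩
    exact ⟨⟨⟨(S.card, Sᶜ.card), Finset.HasAntidiagonal.mem_antidiagonal.2
      ((Finset.card_add_card_compl S).trans (Fintype.card_fin k))⟩, ⟨S, hS, rfl⟩⟩, rfl⟩
  · rintro ⟨⟨⟨a, b⟩, hab⟩, ⟨S, hS, ha⟩⟩
    have hb := Inertia.card_compl_eq (Finset.HasAntidiagonal.mem_antidiagonal.1 hab) ha
    dsimp only at ha hb ⊢
    subst ha hb
    rfl

end SClass

/-! ### The universal cover of the torus. -/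

namespace Torus

variable {n : ℕ}

/-- The universal cover `ℝⁿ → Tⁿ`. -/
noncomputable def expMap (v : Fin n → ℝ) : Torus n := fun j => Circle.exp (2 * Real.pi * v j)

theorem continuous_expMap : Continuous (expMap : (Fin n → ℝ) → Torus n) := by
  unfold expMap
  fun_prop

theorem expMap_add (v w : Fin n → ℝ) : expMap (v + w) = expMap v * expMap w := by
  funext j
  simp [expMap, mul_add, Circle.exp_add]

/-- The inclusion of the lattice in `ℝⁿ`. -/
def latticeVec (m : Fin n → ℤ) : Fin n → ℝ := fun j => m j

theorem latticeVec_add (m m' : Fin n → ℤ) :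
    latticeVec (m + m') = latticeVec m + latticeVec m' := by
  funext j
  simp [latticeVec]

@[simp] theorem latticeVec_zero : latticeVec (0 : Fin n → ℤ) = 0 := by
  funext j
  simp [latticeVec]

@[simp] theorem expMap_zero : expMap (0 : Fin n → ℝ) = 1 := by
  funext j
  simp [expMap]

@[simp] theorem expMap_latticeVec (m : Fin n → ℤ) : expMap (latticeVec m) = 1 := by
  funext j
  simp only [expMap, latticeVec, Pi.one_apply]
  rw [← Circle.exp_zero, Circle.exp_eq_exp]
  exact ⟨m j, by ring⟩

theorem expMap_add_latticeVec (v : Fin n → ℝ) (m : Fin n → ℤ) :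
    expMap (v + latticeVec m) = expMap v := by
  rw [expMap_add, expMap_latticeVec, mul_one]

theorem expMap_eq_expMap {v w : Fin n → ℝ} :
    expMap v = expMap w ↔ ∃ m : Fin n → ℤ, v = w + latticeVec m := by
  constructor
  · intro h
    have h' : ∀ j, ∃ m : ℤ, v j = w j + m := by
      intro j
      obtain ⟨m, hm⟩ := Circle.exp_eq_exp.1 (congrFun h j)
      refine ⟨m, mul_left_cancel₀ Real.two_pi_pos.ne' ?_⟩
      linarith
    choose m hm using h'
    exact ⟨m, funext hm⟩
  · rintro ⟨m, rfl⟩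
    exact expMap_add_latticeVec w m

/-- The integral part of a vector. -/
noncomputable def floorVec (v : Fin n → ℝ) : Fin n → ℤ := fun j => ⌊v j⌋

theorem floorVec_add_latticeVec (v : Fin n → ℝ) (m : Fin n → ℤ) :
    floorVec (v + latticeVec m) = floorVec v + m := by
  funext j
  simp [floorVec, latticeVec]

@[simp] theorem floorVec_zero : floorVec (0 : Fin n → ℝ) = 0 := by
  funext j
  simp [floorVec]

/-- A set-theoretic section of `expMap`. -/
noncomputable def argSection (x z : Torus n) : Fin n → ℝ :=
  fun j => ((x j : ℂ).arg + ((z j / x j : Circle) : ℂ).arg) / (2 * Real.pi)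

@[simp] theorem expMap_argSection (x z : Torus n) : expMap (argSection x z) = z := by
  funext j
  have : 2 * Real.pi * argSection x z j = (x j : ℂ).arg + ((z j / x j : Circle) : ℂ).arg := by
    unfold argSection
    field_simp
  rw [expMap, this, Circle.exp_add, Circle.exp_arg, Circle.exp_arg, mul_div_cancel]

theorem expMap_surjective : Function.Surjective (expMap : (Fin n → ℝ) → Torus n) :=
  fun z => ⟨argSection 1 z, expMap_argSection 1 z⟩

theorem exists_expMap_eq (z : Torus n) : ∃ v : Fin n → ℝ, expMap v = z ∧ floorVec v = 0 := by
  obtain ⟨v, rfl⟩ := expMap_surjective z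
  have h := floorVec_add_latticeVec v (-floorVec v)
  rw [add_neg_cancel] at h
  exact ⟨_, expMap_add_latticeVec v _, h⟩

/-- The neighbourhood of `x` on which `argSection x` is continuous. -/
def slitNhd (x : Torus n) : Set (Torus n) :=
  {z | ∀ j, ((z j / x j : Circle) : ℂ) ∈ Complex.slitPlane}

theorem mem_slitNhd (x : Torus n) : x ∈ slitNhd x := fun j => by simp

theorem isOpen_slitNhd (x : Torus n) : IsOpen (slitNhd x) := by
  have : slitNhd x =
      ⋂ j, (fun z : Torus n => ((z j / x j : Circle) : ℂ)) ⁻¹' Complex.slitPlane := by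
    ext z
    simp [slitNhd]
  rw [this]
  refine isOpen_iInter_of_finite fun j => Complex.isOpen_slitPlane.preimage ?_
  fun_prop

theorem continuousAt_argSection {x z : Torus n} (h : z ∈ slitNhd x) :
    ContinuousAt (argSection x) z := by
  refine continuousAt_pi.2 fun j => ?_
  have h1 : ContinuousAt (fun z : Torus n => ((z j / x j : Circle) : ℂ)) z := by
    apply Continuous.continuousAt
    fun_prop
  exact (continuousAt_const.add (ContinuousAt.comp
    (f := fun z : Torus n => ((z j / x j : Circle) : ℂ))
    (Complex.continuousAt_arg (h j)) h1)).div_const _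

theorem loop_eq_expMap (j : Fin n) (t : unitInterval) :
    loop j t = expMap ((t : ℝ) • latticeVec (Pi.single j 1)) := by
  funext i
  by_cases h : i = j
  · subst h
    simp [loop, expMap, latticeVec]
  · simp [loop, expMap, latticeVec, h]

end Torus

/-! ### Covers of the torus from `ℤⁿ`-sets. -/

open Torus

/-- The cover of the `n`-torus with monodromy the `ℤⁿ`-set `A`. -/
@[ext]
structure Tw (n : ℕ) (A : Type u) : Type u where
  pair ::
  fib : A
  pt : Torus n

namespace Tw

variable {n : ℕ} {A : Type u} {B : Type v}

/-- The projection to the torus. -/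
def proj (p : Tw n A) : Torus n := p.pt

/-- The map of covers induced by a map of `ℤⁿ`-sets. -/
def map (f : A → B) (p : Tw n A) : Tw n B := ⟨f p.fib, p.pt⟩

theorem proj_preimage_finite [Finite A] (x : Torus n) : (proj ⁻¹' {x} : Set (Tw n A)).Finite :=
  Set.Finite.of_finite_image (f := fib) (Set.toFinite _) fun _ hp _ hq h =>
    Tw.ext h (hp.trans hq.symm)

variable [AddAction (Fin n → ℤ) A] [AddAction (Fin n → ℤ) B]

/-- The quotient map `A × ℝⁿ → Tw n A`. -/
noncomputable def mk (a : A) (v : Fin n → ℝ) : Tw n A := ⟨floorVec v +ᵥ a, expMap v⟩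

/-- Only the underlying set is `A × Tⁿ`. The topology is that of the quotient of `A × ℝⁿ`, with `A`
discrete, by `ℤⁿ`. The unit cube serves as fundamental domain, and the floor in `mk` records how
many of its translates have been crossed. -/
noncomputable instance : TopologicalSpace (Tw n A) :=
  ⨆ a : A, TopologicalSpace.coinduced (mk a) inferInstance

@[simp] theorem proj_mk (a : A) (v : Fin n → ℝ) : proj (mk a v) = expMap v := rfl

theorem mk_zero (a : A) : mk a (0 : Fin n → ℝ) = ⟨a, 1⟩ := by
  simp [mk]

/-- This is the gluing relation of the quotient. It fixes the direction of the monodromy: going once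
around the `j`-th loop acts by the `j`-th generator. -/
theorem mk_add_latticeVec (a : A) (v : Fin n → ℝ) (m : Fin n → ℤ) :
    mk a (v + latticeVec m) = mk (m +ᵥ a) v := by
  rw [mk, mk, floorVec_add_latticeVec, expMap_add_latticeVec, add_vadd]

theorem exists_eq_mk (p : Tw n A) : ∃ v : Fin n → ℝ, floorVec v = 0 ∧ p = mk p.fib v := by
  obtain ⟨v, hv, hv'⟩ := exists_expMap_eq p.pt
  refine ⟨v, hv', ?_⟩
  rw [mk, hv', hv, zero_vadd]

theorem continuous_iff {Z : Type*} [TopologicalSpace Z] {f : Tw n A → Z} :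
    Continuous f ↔ ∀ a, Continuous fun v => f (mk a v) := by
  rw [continuous_iSup_dom]
  exact forall_congr' fun a => continuous_coinduced_dom

theorem isOpen_iff {U : Set (Tw n A)} : IsOpen U ↔ ∀ a, IsOpen (mk a ⁻¹' U) := by
  rw [isOpen_iSup_iff]
  exact forall_congr' fun a => isOpen_coinduced

theorem continuous_mk (a : A) : Continuous (mk a : (Fin n → ℝ) → Tw n A) :=
  continuous_iff.1 continuous_id a

theorem continuous_proj : Continuous (proj : Tw n A → Torus n) :=
  continuous_iff.2 fun _ => continuous_expMap

/-- The sheet over `slitNhd x` on which a point lies. -/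
noncomputable def sheet (x : Torus n) (p : Tw n A) : A :=
  (-floorVec (argSection x (proj p))) +ᵥ p.fib

theorem mk_sheet (x : Torus n) (p : Tw n A) : mk (sheet x p) (argSection x (proj p)) = p := by
  rw [mk, sheet, vadd_vadd, add_neg_cancel, zero_vadd, expMap_argSection]
  rfl

theorem sheet_mk_argSection (x z : Torus n) (b : A) : sheet x (mk b (argSection x z)) = b := by
  rw [sheet, proj_mk, expMap_argSection, mk, vadd_vadd, neg_add_cancel, zero_vadd]

theorem floorVec_sub (v w : Fin n → ℝ) (h : expMap v = expMap w) :
    latticeVec (floorVec v - floorVec w) = v - w := by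
  obtain ⟨m, rfl⟩ := expMap_eq_expMap.1 h
  simp [floorVec_add_latticeVec]

/-- Along `mk a`, the sheet depends on the difference of two floors. Each floor jumps, but the
difference equals `w - argSection x (expMap w)`, which is continuous near `v`. Being integral, it is
locally constant. -/
theorem isOpen_sheet (x : Torus n) (b : A) :
    IsOpen {p : Tw n A | proj p ∈ slitNhd x ∧ sheet x p = b} := by
  refine isOpen_iff.2 fun a => isOpen_iff_mem_nhds.2 fun v hv => ?_
  obtain ⟨hv1, hv2⟩ := hv
  rw [proj_mk] at hv1
  let c : (Fin n → ℝ) → Fin n → ℤ := fun w => floorVec w - floorVec (argSection x (expMap w))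
  have hsheet : ∀ w, sheet x (mk a w) = c w +ᵥ a := fun w => by
    rw [sheet, proj_mk, mk, vadd_vadd, neg_add_eq_sub]
  have hc : ∀ᶠ w in nhds v, c w = c v := by
    refine (Filter.eventually_all.2 fun j => ?_).mono fun w hw => funext hw
    have h1 : ContinuousAt (fun w => ((c w j : ℤ) : ℝ)) v := by
      have : (fun w => ((c w j : ℤ) : ℝ)) = fun w => w j - argSection x (expMap w) j := by
        funext w
        exact congrFun (floorVec_sub w (argSection x (expMap w)) (expMap_argSection _ _).symm) j
      rw [this]
      have h2 : ContinuousAt (fun w => argSection x (expMap w)) v :=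
        ContinuousAt.comp (continuousAt_argSection hv1) continuous_expMap.continuousAt
      exact (continuous_apply j).continuousAt.sub (continuousAt_pi.1 h2 j)
    have h2 : ContinuousAt (fun w => c w j) v :=
      Int.isClosedEmbedding_coe_real.isInducing.continuousAt_iff.2 h1
    rw [ContinuousAt, nhds_discrete ℤ, Filter.tendsto_pure] at h2
    exact h2
  have hU : ∀ᶠ w in nhds v, expMap w ∈ slitNhd x :=
    continuous_expMap.continuousAt.eventually ((isOpen_slitNhd x).mem_nhds hv1)
  filter_upwards [hc, hU] with w hw1 hw2
  refine ⟨hw2, ?_⟩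
  rw [← hv2, hsheet, hsheet, hw1]

/-- Over `slitNhd x` the section `argSection x` of the universal cover is continuous, and `sheet x`
is the remaining coordinate of a trivialization with fibre `A`. -/
theorem isCoveringMap_proj : IsCoveringMap (proj : Tw n A → Torus n) := by
  intro x
  let : TopologicalSpace A := ⊥
  have : DiscreteTopology A := ⟨rfl⟩
  refine IsEvenlyCovered.to_isEvenlyCovered_preimage (I := A)
    ⟨inferInstance, slitNhd x, mem_slitNhd x, isOpen_slitNhd x,
      (isOpen_slitNhd x).preimage continuous_proj, ?_⟩
  have hinv : Continuous fun q : slitNhd x × A => mk q.2 (argSection x q.1) := by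
    refine continuous_prod_of_discrete_right.2 fun b => (continuous_mk b).comp ?_
    exact continuous_iff_continuousAt.2 fun z =>
      ContinuousAt.comp (continuousAt_argSection z.2) continuous_subtype_val.continuousAt
  refine ⟨⟨⟨fun p => (⟨proj p.1, p.2⟩, sheet x p.1),
    fun q => ⟨mk q.2 (argSection x q.1), ?_⟩, fun p => ?_, fun q => ?_⟩, ?_, ?_⟩, fun p => rfl⟩
  · change proj (mk q.2 (argSection x q.1)) ∈ slitNhd x
    rw [proj_mk, expMap_argSection]
    exact q.1.2
  · exact Subtype.ext (mk_sheet x p.1)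
  · refine Prod.ext (Subtype.ext ?_) (sheet_mk_argSection x _ _)
    exact expMap_argSection x _
  · refine Continuous.prodMk ((continuous_proj.comp continuous_subtype_val).subtype_mk _) ?_
    refine continuous_discrete_rng.2 fun b => ?_
    convert (isOpen_sheet x b).preimage (continuous_subtype_val (p := (· ∈ proj ⁻¹' slitNhd x)))
      using 1
    ext p
    exact ⟨fun h => ⟨p.2, h⟩, fun h => h.2⟩
  · exact hinv.subtype_mk _

theorem map_mk {f : A → B} (hf : ∀ (m : Fin n → ℤ) a, f (m +ᵥ a) = m +ᵥ f a) (a : A)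
    (v : Fin n → ℝ) : map f (mk a v) = mk (f a) v :=
  Tw.ext (hf _ _) rfl

theorem continuous_map {f : A → B} (hf : ∀ (m : Fin n → ℤ) a, f (m +ᵥ a) = m +ᵥ f a) :
    Continuous (map f : Tw n A → Tw n B) := by
  refine continuous_iff.2 fun a => ?_
  simp_rw [map_mk hf]
  exact continuous_mk _

theorem isLocalHomeomorph_map {f : A → B} (hf : ∀ (m : Fin n → ℤ) a, f (m +ᵥ a) = m +ᵥ f a) :
    IsLocalHomeomorph (map f : Tw n A → Tw n B) :=
  IsLocalHomeomorph.of_comp (g := proj) isCoveringMap_proj.isLocalHomeomorph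
    isCoveringMap_proj.isLocalHomeomorph (continuous_map hf)

/-- Continuous maps over the torus come from equivariant maps. -/
theorem exists_eq_map {F : Tw n A → Tw n B} (hF : Continuous F) (h : ∀ p, proj (F p) = proj p) :
    ∃ f : A → B, (∀ (m : Fin n → ℤ) a, f (m +ᵥ a) = m +ᵥ f a) ∧ F = map f := by
  let f : A → B := fun a => (F (mk a 0)).fib
  have h0 : ∀ a, F (mk a 0) = mk (f a) 0 := fun a => by
    rw [mk_zero (f a)]
    exact Tw.ext rfl ((h _).trans (by rw [proj_mk, expMap_zero]))
  -- Both sides lift `expMap` and agree at `0`; lifts from the connected space `ℝⁿ` are unique.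
  have hmk : ∀ a v, F (mk a v) = mk (f a) v := fun a => congrFun <|
    isCoveringMap_proj.eq_of_comp_eq (hF.comp (continuous_mk a)) (continuous_mk _)
      (funext fun v => h _) 0 (h0 a)
  refine ⟨f, fun m a => ?_, funext fun p => ?_⟩
  -- Compare the two lifts at a lattice point, where the gluing relation turns translation into the
  -- action.
  · have h1 : F (mk (m +ᵥ a) 0) = mk (m +ᵥ f a) 0 := by
      rw [← mk_add_latticeVec, hmk, mk_add_latticeVec]
    rw [h0, mk_zero, mk_zero] at h1
    exact congrArg fib h1
  · obtain ⟨v, hv, hp⟩ := exists_eq_mk p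
    rw [hp, hmk]
    refine Tw.ext ?_ rfl
    simp [map, mk, hv]

end Tw

/-! ### Principal bundles are covering maps on each anchor. -/

namespace PrinBundle

variable {𝒢 : Type u} [Groupoid.{u} 𝒢] {Y : Type u} [TopologicalSpace Y] (P : PrinBundle 𝒢 Y)

/-- A local section of the projection from one anchor `x` trivializes the projections from all
anchors `y`: a point above the section is obtained from it by a unique arrow `x ⟶ y`. The fibre `x ⟶
y` may be empty. -/
theorem isCoveringMap_proj (y : 𝒢) : IsCoveringMap (P.proj y) := by
  intro b
  obtain ⟨x, p, rfl⟩ := P.exists_proj_eq b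
  obtain ⟨e, he, hproj⟩ := P.isLocalHomeomorph_proj x p
  let : TopologicalSpace (x ⟶ y) := ⊥
  have : DiscreteTopology (x ⟶ y) := ⟨rfl⟩
  have hs : ∀ b ∈ e.target, P.proj x (e.symm b) = b := fun b hb => by
    rw [hproj]; exact e.right_inv hb
  have hg : ∀ q : P.proj y ⁻¹' e.target, ∃! g : x ⟶ y, P.tot.map g (e.symm (P.proj y q.1)) = q.1 :=
    fun q => P.existsUnique_map_eq _ _ (hs _ q.2)
  choose γ hγ hγ' using hg
  have hcont : ContinuousOn e.symm e.target := e.continuousOn_symm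
  have hpos : Continuous fun q : P.proj y ⁻¹' e.target => e.symm (P.proj y q.1) :=
    hcont.comp_continuous ((P.isLocalHomeomorph_proj y).continuous.comp continuous_subtype_val)
      fun q => q.2
  refine IsEvenlyCovered.to_isEvenlyCovered_preimage (I := x ⟶ y)
    ⟨inferInstance, e.target, by rw [hproj]; exact e.map_source he, e.open_target,
      e.open_target.preimage (P.isLocalHomeomorph_proj y).continuous,
      ⟨⟨⟨fun q => (⟨P.proj y q.1, q.2⟩, γ q),
        fun r => ⟨P.tot.map r.2 (e.symm r.1.1), ?_⟩, fun q => ?_, fun r => ?_⟩, ?_, ?_⟩,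
        fun q => rfl⟩⟩
  · change P.proj y _ ∈ e.target
    rw [P.proj_map, hs _ r.1.2]
    exact r.1.2
  · exact Subtype.ext (hγ q)
  · refine Prod.ext (Subtype.ext ?_) ?_
    · change P.proj y _ = _
      rw [P.proj_map, hs _ r.1.2]
    · refine (hγ' _ _ ?_).symm
      change P.tot.map r.2 (e.symm (P.proj y _)) = _
      rw [P.proj_map, hs _ r.1.2]
  · refine Continuous.prodMk (((P.isLocalHomeomorph_proj y).continuous.comp
      continuous_subtype_val).subtype_mk _) ?_
    refine continuous_discrete_rng.2 fun g => ?_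
    -- The coordinate is locally constant because the locus where two lifts through a locally
    -- injective map agree is open.
    have h1 : IsOpen {q : P.proj y ⁻¹' e.target | P.tot.map g (e.symm (P.proj y q.1)) = q.1} := by
      refine (P.isLocalHomeomorph_proj y).isLocallyInjective.isOpen_eqLocus
        ((P.tot.map g).hom.continuous.comp hpos) continuous_subtype_val ?_
      funext q
      exact (P.proj_map g _).trans (hs _ q.2)
    convert h1 using 1
    ext q
    exact ⟨fun h => by rw [← Set.mem_singleton_iff.1 h]; exact hγ q, fun h => (hγ' q g h).symm⟩
  · refine (continuous_prod_of_discrete_right.2 fun g => ?_).subtype_mk _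
    exact (P.tot.map g).hom.continuous.comp
      (hcont.comp_continuous continuous_subtype_val fun r => r.2)

end PrinBundle

/-! ### Morphisms of `𝒢`-covers and the induced maps of bases. -/

namespace GCov

variable {𝒢 : Type u} [Groupoid.{u} 𝒢] {X : Type*} [TopologicalSpace X] {P Q S : GCov 𝒢 X}

/-- The projection of the total space of a `𝒢`-cover to `X`. -/
def toX (P : GCov 𝒢 X) (x : 𝒢) (p : P.bundle.tot.obj x) : X := P.cov (P.bundle.proj x p)

theorem isLocalHomeomorph_toX (P : GCov 𝒢 X) (x : 𝒢) : IsLocalHomeomorph (P.toX x) :=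
  P.isCoveringMap_cov.isLocalHomeomorph.comp (P.bundle.isLocalHomeomorph_proj x)

/-- A continuous equivariant bijection over `X` is a morphism of `𝒢`-covers. -/
noncomputable def homOfBijective (Θ : ∀ x, P.bundle.tot.obj x → Q.bundle.tot.obj x)
    (hc : ∀ x, Continuous (Θ x)) (hb : ∀ x, Function.Bijective (Θ x))
    (hn : ∀ {x y : 𝒢} (g : x ⟶ y) p, Θ y (P.bundle.tot.map g p) = Q.bundle.tot.map g (Θ x p))
    (hX : ∀ x p, Q.toX x (Θ x p) = P.toX x p) : P ⟶ Q :=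
  Hom.mk (NatIso.ofComponents (fun x => TopCat.isoOfHomeo
    ((Equiv.ofBijective (Θ x) (hb x)).toHomeomorphOfContinuousOpen (hc x)
      -- A continuous map between spaces étale over `X` is a local homeomorphism, hence open.
      (IsLocalHomeomorph.of_comp (g := Q.toX x)
        ((funext (hX x) : Q.toX x ∘ Θ x = P.toX x) ▸ P.isLocalHomeomorph_toX x)
        (Q.isLocalHomeomorph_toX x) (hc x)).isOpenMap))
    fun g => TopCat.ext fun p => hn g p) hX

theorem exists_hom_of_bijective (Θ : ∀ x, P.bundle.tot.obj x → Q.bundle.tot.obj x)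
    (hc : ∀ x, Continuous (Θ x)) (hb : ∀ x, Function.Bijective (Θ x))
    (hn : ∀ {x y : 𝒢} (g : x ⟶ y) p, Θ y (P.bundle.tot.map g p) = Q.bundle.tot.map g (Θ x p))
    (hX : ∀ x p, Q.toX x (Θ x p) = P.toX x p) : Nonempty (P ⟶ Q) :=
  ⟨homOfBijective Θ hc hb hn hX⟩

/-- The map of total spaces underlying a morphism. -/
def Hom.app (f : P ⟶ Q) (x : 𝒢) (p : P.bundle.tot.obj x) : Q.bundle.tot.obj x :=
  (Hom.iso f).hom.app x p

theorem Hom.continuous_app (f : P ⟶ Q) (x : 𝒢) : Continuous (Hom.app f x) :=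
  ((Hom.iso f).hom.app x).hom.continuous

theorem Hom.app_map (f : P ⟶ Q) {x y : 𝒢} (g : x ⟶ y) (p : P.bundle.tot.obj x) :
    Hom.app f y (P.bundle.tot.map g p) = Q.bundle.tot.map g (Hom.app f x p) :=
  ConcreteCategory.congr_hom ((Hom.iso f).hom.naturality g) p

theorem Hom.app_comp (f : P ⟶ Q) (g : Q ⟶ S) (x : 𝒢) (p : P.bundle.tot.obj x) :
    Hom.app (f ≫ g) x p = Hom.app g x (Hom.app f x p) := rfl

theorem Hom.app_id (x : 𝒢) (p : P.bundle.tot.obj x) : Hom.app (𝟙 P) x p = p := rfl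

theorem Hom.ext_app {f g : P ⟶ Q} (h : ∀ x p, Hom.app f x p = Hom.app g x p) : f = g :=
  Hom.ext (Iso.ext (NatTrans.ext (funext fun x => TopCat.ext (h x))))

theorem Hom.inv_app_app (f : P ⟶ Q) (x : 𝒢) (p : P.bundle.tot.obj x) :
    Hom.app (Groupoid.inv f) x (Hom.app f x p) = p := by
  rw [← Hom.app_comp, Groupoid.comp_inv, Hom.app_id]

theorem Hom.app_bijective (f : P ⟶ Q) (x : 𝒢) : Function.Bijective (Hom.app f x) := by
  refine Function.bijective_iff_has_inverse.2 ⟨Hom.app (Groupoid.inv f) x, Hom.inv_app_app f x, ?_⟩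
  intro p
  rw [← Hom.app_comp, Groupoid.inv_comp, Hom.app_id]

/-- Equivariant maps preserve the fibres of the projections to the bases. -/
theorem Hom.proj_app_eq (f : P ⟶ Q) {x y : 𝒢} {p : P.bundle.tot.obj x} {q : P.bundle.tot.obj y}
    (h : P.bundle.proj x p = P.bundle.proj y q) :
    Q.bundle.proj x (Hom.app f x p) = Q.bundle.proj y (Hom.app f y q) := by
  obtain ⟨g, rfl, -⟩ := P.bundle.existsUnique_map_eq p q h
  rw [Hom.app_map, Q.bundle.proj_map]

/-- The map of bases underlying a morphism. -/
noncomputable def Hom.base (f : P ⟶ Q) (b : P.base) : Q.base :=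
  Q.bundle.proj _ (Hom.app f _ (P.bundle.exists_proj_eq b).choose_spec.choose)

theorem Hom.base_proj (f : P ⟶ Q) (x : 𝒢) (p : P.bundle.tot.obj x) :
    Hom.base f (P.bundle.proj x p) = Q.bundle.proj x (Hom.app f x p) :=
  Hom.proj_app_eq f (P.bundle.exists_proj_eq _).choose_spec.choose_spec

/-- Continuity may be tested on `P`, since the projections to the base are étale and jointly
surjective. -/
theorem Hom.continuous_base (f : P ⟶ Q) : Continuous (Hom.base f) := by
  refine continuous_iff_continuousAt.2 fun b => ?_
  obtain ⟨x, p, rfl⟩ := P.bundle.exists_proj_eq b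
  rw [ContinuousAt, ← (P.bundle.isLocalHomeomorph_proj x).map_nhds_eq p, Filter.tendsto_map'_iff,
    Hom.base_proj]
  have : Hom.base f ∘ P.bundle.proj x = fun p => Q.bundle.proj x (Hom.app f x p) :=
    funext (Hom.base_proj f x)
  rw [this]
  exact ((Q.bundle.isLocalHomeomorph_proj x).continuous.comp (Hom.continuous_app f x)).continuousAt

theorem Hom.cov_base (f : P ⟶ Q) (b : P.base) : Q.cov (Hom.base f b) = P.cov b := by
  obtain ⟨x, p, rfl⟩ := P.bundle.exists_proj_eq b
  rw [Hom.base_proj]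
  exact Hom.comm f x p

theorem Hom.inv_base_base (f : P ⟶ Q) (b : P.base) :
    Hom.base (Groupoid.inv f) (Hom.base f b) = b := by
  obtain ⟨x, p, rfl⟩ := P.bundle.exists_proj_eq b
  rw [Hom.base_proj, Hom.base_proj, Hom.inv_app_app]

/-- The homeomorphism of bases underlying a morphism. -/
noncomputable def Hom.baseHomeo (f : P ⟶ Q) : P.base ≃ₜ Q.base where
  toFun := Hom.base f
  invFun := Hom.base (Groupoid.inv f)
  left_inv := Hom.inv_base_base f
  right_inv b := by
    have h := Hom.inv_base_base (Groupoid.inv f) b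
    rwa [show Groupoid.inv (Groupoid.inv f) = f by simp] at h
  continuous_toFun := Hom.continuous_base f
  continuous_invFun := Hom.continuous_base _

theorem Hom.ncard_fibre (f : P ⟶ Q) (x : X) : (P.cov ⁻¹' {x}).ncard = (Q.cov ⁻¹' {x}).ncard := by
  have : Q.cov ⁻¹' {x} = (Hom.baseHomeo f) '' (P.cov ⁻¹' {x}) := by
    rw [(Hom.baseHomeo f).image_eq_preimage_symm]
    ext b
    change _ ↔ P.cov (Hom.base (Groupoid.inv f) b) = x
    rw [Hom.cov_base]
    rfl
  rw [this, Set.ncard_image_of_injective _ (Hom.baseHomeo f).injective]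

theorem IsKFold.of_hom {k : ℕ} (h : P.IsKFold k) (f : P ⟶ Q) : Q.IsKFold k := fun x => by
  rw [← Hom.ncard_fibre f, h x]

theorem IsKFold.eq {x : X} {k l : ℕ} (h : P.IsKFold k) (h' : P.IsKFold l) : k = l :=
  (h x).symm.trans (h' x)

/-- A morphism restricts to corresponding open and closed subsets of the bases. -/
theorem exists_hom_restrict (f : P ⟶ Q) (U : TopologicalSpace.Clopens P.base)
    (V : TopologicalSpace.Clopens Q.base) (h : ∀ b, Hom.base f b ∈ V ↔ b ∈ U) :
    Nonempty (P.restrict U ⟶ Q.restrict V) := by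
  refine exists_hom_of_bijective (P := P.restrict U) (Q := Q.restrict V)
    (fun x p => ⟨Hom.app f x p.1, ?_⟩) (fun x => ?_) (fun x => ⟨?_, ?_⟩) (fun {x y} g p => ?_)
    fun x p => ?_
  · have h1 := (h _).2 p.2
    rw [Hom.base_proj] at h1
    exact h1
  · exact ((Hom.continuous_app f x).comp continuous_subtype_val).subtype_mk _
  · intro p q hpq
    exact Subtype.ext ((Hom.app_bijective f x).1 (congrArg Subtype.val hpq))
  · intro q
    obtain ⟨p, hp⟩ := (Hom.app_bijective f x).2 q.1
    refine ⟨⟨p, (h _).1 ?_⟩, Subtype.ext hp⟩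
    rw [Hom.base_proj, hp]
    exact q.2
  · exact Subtype.ext (Hom.app_map f g p.1)
  · exact Hom.comm f x p.1

end GCov

/-! ### Lattice actions and the cover with given holonomy. -/

/-- An induction principle for the lattice `ℤⁿ`. -/
theorem lattice_induction {n : ℕ} {p : (Fin n → ℤ) → Prop} (zero : p 0)
    (add : ∀ m m', p m → p m' → p (m + m')) (neg : ∀ m, p m → p (-m))
    (single : ∀ j, p (Pi.single j 1)) (m : Fin n → ℤ) : p m := by
  let S : AddSubgroup (Fin n → ℤ) :=
    { carrier := {m | p m}
      zero_mem' := zero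
      add_mem' := fun {m m'} hm hm' => add m m' hm hm'
      neg_mem' := fun {m} hm => neg m hm }
  have hm : m ∈ S := by
    rw [← Finset.univ_sum_single m]
    refine sum_mem fun j _ => ?_
    have : (Pi.single j (m j) : Fin n → ℤ) = m j • Pi.single j 1 := by
      rw [← Pi.single_smul, smul_eq_mul, mul_one]
    rw [this]
    exact S.zsmul_mem (single j) _
  exact hm

/-- A map of `ℤⁿ`-sets is equivariant if it commutes with the generators. -/
theorem equivariant_of_single {n : ℕ} {A B : Type*} [AddAction (Fin n → ℤ) A]
    [AddAction (Fin n → ℤ) B] {f : A → B}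
    (hf : ∀ j a, f ((Pi.single j 1 : Fin n → ℤ) +ᵥ a) = (Pi.single j 1 : Fin n → ℤ) +ᵥ f a)
    (m : Fin n → ℤ) (a : A) : f (m +ᵥ a) = m +ᵥ f a := by
  revert a
  refine lattice_induction (p := fun m => ∀ a, f (m +ᵥ a) = m +ᵥ f a) (fun a => by simp)
    (fun m m' hm hm' a => ?_) (fun m hm a => ?_) hf m
  · rw [add_vadd, hm, hm', add_vadd]
  · have h := hm (-m +ᵥ a)
    rw [vadd_vadd, add_neg_cancel, zero_vadd] at h
    rw [h, vadd_vadd, neg_add_cancel, zero_vadd]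

namespace Inertia

section

variable {n : ℕ} {C : Type*} [Groupoid C]

/-- The `j`-th automorphism, as an element of the automorphism group. -/
def toAut (x : Inertia n C) (j : Fin n) : Aut x.pt :=
  (Groupoid.isoEquivHom x.pt x.pt).symm (x.aut j)

theorem commute_toAut (x : Inertia n C) (i j : Fin n) : Commute (x.toAut i) (x.toAut j) :=
  Iso.ext (x.comm j i)

theorem pairwise_commute (x : Inertia n C) : _root_.Pairwise fun i j => ∀ a b : Multiplicative ℤ,
    Commute (zpowersHom (Aut x.pt) (x.toAut i) a) (zpowersHom (Aut x.pt) (x.toAut j) b) := by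
  intro i j _ a b
  simp only [zpowersHom_apply]
  exact (x.commute_toAut i j).zpow_zpow _ _

/-- The action of `ℤⁿ` by automorphisms that an object of the inertia groupoid amounts to. -/
noncomputable def latticeHom (x : Inertia n C) : (Fin n → Multiplicative ℤ) →* Aut x.pt :=
  MonoidHom.noncommPiCoprod (fun j => zpowersHom (Aut x.pt) (x.toAut j)) x.pairwise_commute

/-- The automorphism by which an element of `ℤⁿ` acts. -/
noncomputable def lattice (x : Inertia n C) (m : Fin n → ℤ) : x.pt ⟶ x.pt :=
  (x.latticeHom fun j => Multiplicative.ofAdd (m j)).hom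

theorem lattice_zero (x : Inertia n C) : x.lattice 0 = 𝟙 _ := by
  have : (fun j => Multiplicative.ofAdd ((0 : Fin n → ℤ) j)) = 1 := rfl
  rw [lattice, this, map_one]
  rfl

theorem lattice_add (x : Inertia n C) (m m' : Fin n → ℤ) :
    x.lattice (m + m') = x.lattice m' ≫ x.lattice m := by
  have : (fun j => Multiplicative.ofAdd ((m + m') j)) =
    (fun j => Multiplicative.ofAdd (m j)) * fun j => Multiplicative.ofAdd (m' j) := rfl
  rw [lattice, this, map_mul]
  rfl

theorem lattice_single (x : Inertia n C) (j : Fin n) : x.lattice (Pi.single j 1) = x.aut j := by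
  have : (fun i => Multiplicative.ofAdd ((Pi.single j 1 : Fin n → ℤ) i)) =
      Pi.mulSingle j (Multiplicative.ofAdd 1) := by
    funext i
    by_cases h : i = j
    · subst h; simp
    · simp [h]
  rw [lattice, this, latticeHom, MonoidHom.noncommPiCoprod_mulSingle, zpowersHom_apply, toAdd_ofAdd,
    zpow_one]
  rfl

end

variable {n : ℕ} {I : Type} {𝒢 : Type u} [Groupoid.{u} 𝒢]

/-- The fibre at the base point, with anchor `y`, of the total space of the `𝒢`-cover with
holonomy `x`. -/
@[ext]
structure Fib (x : Inertia n (Wreath I 𝒢)) (y : 𝒢) : Type u where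
  idx : I
  arr : x.pt.pt idx ⟶ y

/-- The fibre at the base point of the cover with holonomy `x`. -/
@[ext]
structure Idx (x : Inertia n (Wreath I 𝒢)) : Type u where
  idx : I

namespace Fib

variable {x x' x'' : Inertia n (Wreath I 𝒢)} {y z : 𝒢}

/-- The action of an arrow of the symmetric power on the fibres. -/
def act (f : x.pt ⟶ x'.pt) (a : x.Fib y) : x'.Fib y :=
  ⟨f.perm a.idx, Groupoid.inv (f.arr a.idx _ rfl) ≫ a.arr⟩

theorem act_mk (f : x.pt ⟶ x'.pt) {i l : I} (h : f.perm i = l) (a : x.pt.pt i ⟶ y) :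
    act f ⟨i, a⟩ = ⟨l, Groupoid.inv (f.arr i l h) ≫ a⟩ := by
  subst h
  rfl

theorem act_id (a : x.Fib y) : act (𝟙 x.pt) a = a := by
  obtain ⟨i, a⟩ := a
  rw [act_mk (𝟙 x.pt) (l := i) rfl]
  congr
  have : Wreath.Hom.arr (𝟙 x.pt) i i rfl = 𝟙 _ := rfl
  rw [this]
  simp

theorem act_comp (f : x.pt ⟶ x'.pt) (g : x'.pt ⟶ x''.pt) (a : x.Fib y) :
    act (f ≫ g) a = act g (act f a) := by
  obtain ⟨i, a⟩ := a
  have h : (f ≫ g).perm i = g.perm (f.perm i) := rfl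
  rw [act_mk f rfl, act_mk g rfl, act_mk (f ≫ g) h, Wreath.comp_arr f g _ rfl rfl]
  simp

theorem act_bijective (f : x.pt ⟶ x'.pt) (y : 𝒢) :
    Function.Bijective (act f : x.Fib y → x'.Fib y) := by
  refine Function.bijective_iff_has_inverse.2 ⟨act (Groupoid.inv f), fun a => ?_, fun a => ?_⟩
  · rw [← act_comp, Groupoid.comp_inv, act_id]
  · rw [← act_comp, Groupoid.inv_comp, act_id]

/-- The action of an arrow of `𝒢` on the fibre. -/
def comp (g : y ⟶ z) (a : x.Fib y) : x.Fib z := ⟨a.idx, a.arr ≫ g⟩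

theorem act_comp_right (f : x.pt ⟶ x'.pt) (g : y ⟶ z) (a : x.Fib y) :
    act f (comp g a) = comp g (act f a) := by
  simp [act, comp]

/-- The Yoneda argument: the action on the points `(i, 𝟙)` recovers the permutation and the inverses
of the arrows. -/
theorem hom_ext_act {f g : x.pt ⟶ x'.pt} (h : ∀ (y : 𝒢) (a : x.Fib y), act f a = act g a) :
    f = g := by
  refine Wreath.Hom.ext' (fun i => congrArg Fib.idx (h _ ⟨i, 𝟙 _⟩)) fun i j hf hg => ?_
  have h1 := h _ ⟨i, 𝟙 _⟩
  rw [act_mk f hf, act_mk g hg] at h1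
  have h2 : Groupoid.inv (f.arr i j hf) = Groupoid.inv (g.arr i j hg) := by simpa using h1
  rwa [Groupoid.inv_eq_inv, Groupoid.inv_eq_inv, IsIso.inv_eq_inv] at h2

/-- The index of a point of the fibre. -/
def toIdx (a : x.Fib y) : x.Idx := ⟨a.idx⟩

end Fib

noncomputable instance (x : Inertia n (Wreath I 𝒢)) (y : 𝒢) : AddAction (Fin n → ℤ) (x.Fib y) where
  vadd m a := Fib.act (x.lattice m) a
  zero_vadd a := by
    change Fib.act (x.lattice 0) a = a
    rw [lattice_zero, Fib.act_id]
  add_vadd m m' a := by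
    change Fib.act (x.lattice (m + m')) a = Fib.act _ (Fib.act _ a)
    rw [lattice_add, Fib.act_comp]

noncomputable instance (x : Inertia n (Wreath I 𝒢)) : AddAction (Fin n → ℤ) x.Idx where
  vadd m a := ⟨(x.lattice m).perm a.idx⟩
  zero_vadd a := by
    change Idx.mk ((x.lattice 0).perm a.idx) = a
    rw [lattice_zero]
    rfl
  add_vadd m m' a := by
    change Idx.mk ((x.lattice (m + m')).perm a.idx) = _
    rw [lattice_add]
    rfl

instance (x : Inertia n (Wreath I 𝒢)) [Finite I] : Finite x.Idx :=
  Finite.of_injective Idx.idx fun _ _ => Idx.ext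

theorem vadd_fib (x : Inertia n (Wreath I 𝒢)) {y : 𝒢} (m : Fin n → ℤ) (a : x.Fib y) :
    m +ᵥ a = Fib.act (x.lattice m) a := rfl

theorem single_vadd_fib (x : Inertia n (Wreath I 𝒢)) {y : 𝒢} (j : Fin n) (a : x.Fib y) :
    (Pi.single j 1 : Fin n → ℤ) +ᵥ a = Fib.act (x.aut j) a := by
  rw [vadd_fib, lattice_single]

theorem single_vadd_idx (x : Inertia n (Wreath I 𝒢)) (j : Fin n) (i : x.Idx) :
    (Pi.single j 1 : Fin n → ℤ) +ᵥ i = ⟨(x.aut j).perm i.idx⟩ := by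
  rw [← lattice_single]
  rfl

namespace Fib

variable {x x' : Inertia n (Wreath I 𝒢)} {y z : 𝒢}

theorem toIdx_vadd (m : Fin n → ℤ) (a : x.Fib y) : (m +ᵥ a).toIdx = m +ᵥ a.toIdx := rfl

theorem comp_vadd (g : y ⟶ z) (m : Fin n → ℤ) (a : x.Fib y) :
    comp g (m +ᵥ a) = m +ᵥ comp g a :=
  (act_comp_right _ _ _).symm

theorem act_vadd (f : x ⟶ x') (m : Fin n → ℤ) (a : x.Fib y) :
    act f.arr (m +ᵥ a) = m +ᵥ act f.arr a := by
  refine equivariant_of_single (fun j a => ?_) m a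
  rw [single_vadd_fib, single_vadd_fib, ← act_comp, ← act_comp, f.conj]

end Fib

/-- The `𝒢`-cover of the torus with holonomy `x`. -/
noncomputable def cover [Finite I] (x : Inertia n (Wreath I 𝒢)) : GCov 𝒢 (Torus n) where
  base := Tw n x.Idx
  cov := Tw.proj
  isCoveringMap_cov := Tw.isCoveringMap_proj
  finite_fibre := Tw.proj_preimage_finite
  bundle :=
    { tot :=
        { obj y := TopCat.of (Tw n (x.Fib y))
          map g := TopCat.ofHom ⟨Tw.map (Fib.comp g), Tw.continuous_map (Fib.comp_vadd g)⟩
          map_id y := by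
            refine TopCat.ext fun p => ?_
            change Tw.pair (Fib.comp (𝟙 y) p.fib) p.pt = p
            simp [Fib.comp]
          map_comp f g := by
            refine TopCat.ext fun p => ?_
            change Tw.pair (Fib.comp (f ≫ g) p.fib) p.pt =
              Tw.pair (Fib.comp g (Fib.comp f p.fib)) p.pt
            simp [Fib.comp] }
      proj y := Tw.map Fib.toIdx
      proj_map _ _ := rfl
      isLocalHomeomorph_proj y := Tw.isLocalHomeomorph_map Fib.toIdx_vadd
      exists_proj_eq b := ⟨x.pt.pt b.fib.idx, ⟨⟨b.fib.idx, 𝟙 _⟩, b.pt⟩, rfl⟩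
      existsUnique_map_eq := by
        rintro y z ⟨⟨i, h⟩, t⟩ ⟨⟨i', h'⟩, t'⟩ e
        obtain rfl : i = i' := congrArg (fun p : Tw n x.Idx => p.fib.idx) e
        obtain rfl : t = t' := congrArg Tw.pt e
        refine ⟨Groupoid.inv h ≫ h', ?_, fun g hg => ?_⟩
        · change Tw.pair (Fib.mk i (h ≫ Groupoid.inv h ≫ h')) t = _
          simp
        · have h1 : (⟨i, h ≫ g⟩ : x.Fib z) = ⟨i, h'⟩ := congrArg Tw.fib hg
          have h2 : h ≫ g = h' := by simpa using h1
          rw [← h2]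
          simp }

/-- The map of covers induced by an arrow. -/
noncomputable def coverMap [Finite I] {x x' : Inertia n (Wreath I 𝒢)} (f : x ⟶ x') :
    x.cover ⟶ x'.cover :=
  GCov.homOfBijective (P := x.cover) (Q := x'.cover)
    (fun y => (Tw.map (Fib.act f.arr) : Tw n (x.Fib y) → Tw n (x'.Fib y)))
    (fun y => Tw.continuous_map (A := x.Fib y) (B := x'.Fib y) (Fib.act_vadd f))
    (fun y => by
      have h := Fib.act_bijective f.arr y
      refine ⟨fun p q hpq => Tw.ext (h.1 (congrArg Tw.fib hpq)) (congrArg Tw.pt hpq :), fun q => ?_⟩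
      obtain ⟨a, ha⟩ := h.2 (Tw.fib q)
      exact ⟨Tw.pair a (Tw.pt q), Tw.ext ha rfl⟩)
    (fun g p => Tw.ext (Fib.act_comp_right f.arr g (Tw.fib p)) rfl)
    (fun _ _ => rfl)

theorem coverMap_app [Finite I] {x x' : Inertia n (Wreath I 𝒢)} (f : x ⟶ x') (y : 𝒢)
    (p : Tw n (x.Fib y)) : GCov.Hom.app (coverMap f) y p =
      (Tw.map (Fib.act f.arr) p : Tw n (x'.Fib y)) := by
  rfl

/-- The functor that sends holonomy data to the `𝒢`-cover with this holonomy. -/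
noncomputable def coverFunctor (n : ℕ) (I : Type) [Finite I] (𝒢 : Type u) [Groupoid.{u} 𝒢] :
    Inertia n (Wreath I 𝒢) ⥤ GCov 𝒢 (Torus n) where
  obj := cover
  map := coverMap
  map_id _ := GCov.Hom.ext_app fun _ _ =>
    (coverMap_app _ _ _).trans (Tw.ext (Fib.act_id _) rfl)
  map_comp _ _ := GCov.Hom.ext_app fun _ _ =>
    (coverMap_app _ _ _).trans (Tw.ext (Fib.act_comp _ _ _) rfl)

instance [Finite I] : (coverFunctor n I 𝒢).Faithful where
  map_injective {x x'} f g h := by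
    refine Hom.ext (Fib.hom_ext_act fun y a => ?_)
    have h1 : (Tw.map (Fib.act f.arr) ⟨a, 1⟩ : Tw n (x'.Fib y)) = Tw.map (Fib.act g.arr) ⟨a, 1⟩ :=
      congrArg (fun f : x.cover ⟶ x'.cover => GCov.Hom.app f y (Tw.pair a 1 : Tw n (x.Fib y))) h
    exact congrArg Tw.fib h1

/-- Morphisms of covers of the torus come from maps of the fibres. -/
theorem exists_app_eq_map [Finite I] {x x' : Inertia n (Wreath I 𝒢)} (F : x.cover ⟶ x'.cover) :
    ∃ φ : ∀ y, x.Fib y → x'.Fib y, (∀ y (m : Fin n → ℤ) a, φ y (m +ᵥ a) = m +ᵥ φ y a) ∧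
      (∀ {y z : 𝒢} (g : y ⟶ z) (a : x.Fib y), φ z (a.comp g) = (φ y a).comp g) ∧
      (∀ y, Function.Injective (φ y)) ∧ ∀ y (p : Tw n (x.Fib y)), GCov.Hom.app F y p =
        (Tw.map (φ y) p : Tw n (x'.Fib y)) := by
  have hex : ∀ y, ∃ f : x.Fib y → x'.Fib y, (∀ (m : Fin n → ℤ) a, f (m +ᵥ a) = m +ᵥ f a) ∧
      GCov.Hom.app F y = Tw.map f := fun y =>
    Tw.exists_eq_map (GCov.Hom.continuous_app F y) fun p => GCov.Hom.comm F y p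
  choose φ hφ hF using hex
  refine ⟨φ, hφ, fun {y z} g a => ?_, fun y a b hab => ?_, fun y p => congrFun (hF y) p⟩
  · have h1 := GCov.Hom.app_map F g (Tw.pair a 1 : Tw n (x.Fib y))
    rw [hF, hF] at h1
    exact congrArg Tw.fib h1
  · have h1 := (GCov.Hom.app_bijective F y).1
    rw [hF] at h1
    exact congrArg Tw.fib (@h1 (Tw.pair a 1 : Tw n (x.Fib y)) (Tw.pair b 1 : Tw n (x.Fib y))
      (Tw.ext hab rfl))

/-- By Yoneda again, a family of maps of fibres natural in `y` is determined by its values at the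
points `(i, 𝟙)`. These values supply a permutation `σ` and arrows `h i`, and `ℤⁿ`-equivariance
becomes the conjugation condition. -/
instance [Finite I] : (coverFunctor n I 𝒢).Full where
  map_surjective {x x'} F := by
    obtain ⟨φ, hφ, hnat, hinj, hF⟩ := exists_app_eq_map (x := x) (x' := x') F
    let σ : I → I := fun i => (φ _ ⟨i, 𝟙 _⟩).idx
    let h : ∀ i, x'.pt.pt (σ i) ⟶ x.pt.pt i := fun i => (φ _ ⟨i, 𝟙 _⟩).arr
    have hφ' : ∀ y i (g : x.pt.pt i ⟶ y), φ y ⟨i, g⟩ = ⟨σ i, h i ≫ g⟩ := by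
      intro y i g
      have h1 := hnat g ⟨i, 𝟙 _⟩
      simp only [Fib.comp, Category.id_comp] at h1
      exact h1
    -- If `σ i = σ i'`, the images of the points at `i` and `i'` differ by an arrow of `𝒢`, so the
    -- image at `i` is also the image of a point with index `i'`. Injectivity on the fibre then
    -- gives `i = i'`.
    have hσ : Function.Injective σ := by
      intro i i' hi
      have key : ∀ (l l' : I) (hl : l = l') (u : x'.pt.pt l ⟶ x.pt.pt i)
          (u' : x'.pt.pt l' ⟶ x.pt.pt i'), ∃ v : x.pt.pt i' ⟶ x.pt.pt i,
            (⟨l, u⟩ : x'.Fib (x.pt.pt i)) = ⟨l', u' ≫ v⟩ := by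
        rintro l l' rfl u u'
        exact ⟨Groupoid.inv u' ≫ u, by simp⟩
      obtain ⟨v, hv⟩ := key _ _ hi (h i ≫ 𝟙 _) (h i')
      rw [← hφ', ← hφ'] at hv
      exact congrArg Fib.idx (hinj _ hv)
    let f : x.pt ⟶ x'.pt := Wreath.Hom.mk
      (Equiv.ofBijective σ (Finite.injective_iff_bijective.1 hσ))
      fun i l e => Groupoid.inv (h i) ≫ eqToHom (congrArg x'.pt.pt e)
    have hact : ∀ y (a : x.Fib y), Fib.act f a = φ y a := by
      rintro y ⟨i, g⟩
      rw [Fib.act_mk f (l := σ i) rfl, hφ']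
      simp [f]
    refine ⟨⟨f, fun j => Fib.hom_ext_act fun y a => ?_⟩, GCov.Hom.ext_app fun y p => ?_⟩
    · rw [Fib.act_comp, Fib.act_comp, hact, hact, ← single_vadd_fib, ← single_vadd_fib, hφ]
    · refine Eq.trans ?_ (hF y p).symm
      exact Tw.ext (hact _ _) rfl

theorem isKFold_cover {k : ℕ} (x : Inertia n (Wreath (Fin k) 𝒢)) : x.cover.IsKFold k := by
  intro z
  have : (x.cover.cov ⁻¹' {z}) = Set.range fun i : Fin k => (⟨⟨i⟩, z⟩ : Tw n x.Idx) := by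
    ext b
    constructor
    · intro hb
      exact ⟨b.fib.idx, Tw.ext rfl hb.symm⟩
    · rintro ⟨i, rfl⟩
      rfl
  rw [this, ← Set.image_univ]
  refine (Set.ncard_image_of_injective Set.univ fun i i' h => ?_).trans
    ((Set.ncard_univ _).trans (Nat.card_fin k))
  exact congrArg (fun p : Tw n x.Idx => p.fib.idx) h

theorem hasHolonomy_cover {k : ℕ} (x : Inertia n (Wreath (Fin k) 𝒢)) :
    x.cover.HasHolonomy x := by
  refine ⟨fun i => (⟨⟨i, 𝟙 _⟩, 1⟩ : Tw n (x.Fib _)), ⟨?_, ?_, ?_⟩, fun j i => ?_⟩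
  · intro i _
    rfl
  · intro i _ i' _ h
    exact congrArg (fun p : Tw n x.Idx => p.fib.idx) h
  · intro b hb
    exact ⟨b.fib.idx, trivial, Tw.ext rfl hb.symm⟩
  · let a : x.Fib (x.pt.pt i) := ⟨i, 𝟙 _⟩
    refine ⟨fun t => Tw.mk a ((t : ℝ) • latticeVec (Pi.single j 1)), ?_, ?_, ?_, ?_⟩
    · exact (Tw.continuous_mk a).comp (by fun_prop)
    · simp only [Set.Icc.coe_zero, zero_smul]
      exact Tw.mk_zero a
    · intro t
      rw [loop_eq_expMap]
      rfl
    -- The path is the image of the segment from `0` to the `j`-th basis vector, so its end is the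
    -- generator applied to `a`. The action on fibres uses the inverse arrow, which the arrow in
    -- `HasHolonomy` cancels.
    · have h1 : Tw.mk a (((1 : unitInterval) : ℝ) • latticeVec (Pi.single j 1)) =
          ⟨Fib.act (x.aut j) a, 1⟩ := by
        rw [← single_vadd_fib, ← Tw.mk_zero, ← Tw.mk_add_latticeVec]
        simp
      refine (congrArg (Tw.map (Fib.comp ((x.aut j).arr i ((x.aut j).perm i) rfl))) h1).trans ?_
      refine Tw.ext ?_ rfl
      refine Fib.ext rfl (heq_of_eq ?_)
      change (Groupoid.inv _ ≫ 𝟙 _) ≫ _ = 𝟙 _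
      rw [Category.comp_id]
      exact Groupoid.inv_comp _

end Inertia

/-! ### The holonomy of a cover. -/

namespace GCov

variable {n : ℕ} {𝒢 : Type u} [Groupoid.{u} 𝒢] (P : GCov 𝒢 (Torus n))

theorem toX_map {y z : 𝒢} (g : y ⟶ z) (p : P.bundle.tot.obj y) :
    P.toX z (P.bundle.tot.map g p) = P.toX y p := by
  unfold toX
  rw [P.bundle.proj_map]

theorem map_comp_apply {x y z : 𝒢} (f : x ⟶ y) (g : y ⟶ z) (p : P.bundle.tot.obj x) :
    P.bundle.tot.map (f ≫ g) p = P.bundle.tot.map g (P.bundle.tot.map f p) :=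
  ConcreteCategory.congr_hom (P.bundle.tot.map_comp f g) p

/-- The universal cover `ℝⁿ → Tⁿ` lifts to the total space of a `𝒢`-cover. -/
theorem exists_lift {y : 𝒢} (p : P.bundle.tot.obj y) (v₀ : Fin n → ℝ) (h : P.toX y p = expMap v₀) :
    ∃ F : (Fin n → ℝ) → P.bundle.tot.obj y, Continuous F ∧ F v₀ = p ∧
      ∀ v, P.toX y (F v) = expMap v := by
  -- Lift in two stages, first to `Y` and then to `P`; both maps are coverings and `ℝⁿ` is simply
  -- connected.
  obtain ⟨G, ⟨hG, hG'⟩, -⟩ := P.isCoveringMap_cov.existsUnique_continuousMap_lifts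
    ⟨expMap, continuous_expMap⟩ v₀ (P.bundle.proj y p) h
  obtain ⟨F, ⟨hF, hF'⟩, -⟩ := (P.bundle.isCoveringMap_proj y).existsUnique_continuousMap_lifts
    G v₀ p hG.symm
  refine ⟨F, F.continuous, hF, fun v => ?_⟩
  have h1 := congrFun hF' v
  rw [Function.comp_apply] at h1
  rw [toX, h1]
  exact congrFun hG' v

theorem lift_unique {y : 𝒢} {F G : (Fin n → ℝ) → P.bundle.tot.obj y} (hF : Continuous F)
    (hG : Continuous G) (h : ∀ v, P.toX y (F v) = P.toX y (G v)) {v₀ : Fin n → ℝ}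
    (h₀ : F v₀ = G v₀) : F = G := by
  have hc := (P.bundle.isLocalHomeomorph_proj y).continuous
  have h1 := P.isCoveringMap_cov.eq_of_comp_eq (hc.comp hF) (hc.comp hG) (funext h) v₀
    (congrArg _ h₀)
  exact (P.bundle.isCoveringMap_proj y).eq_of_comp_eq hF hG h1 v₀ h₀

/-- A numbering of the fibre at the base point, with points of the total space above it. -/
structure Frame (k : ℕ) where
  anchor : Fin k → 𝒢
  pt : ∀ i, P.bundle.tot.obj (anchor i)
  injective : Function.Injective fun i => P.bundle.proj _ (pt i)
  toX_pt : ∀ i, P.toX _ (pt i) = 1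
  exists_proj_eq : ∀ b, P.cov b = 1 → ∃ i, P.bundle.proj _ (pt i) = b

theorem exists_frame : ∃ k, Nonempty (P.Frame k) := by
  have := (P.finite_fibre 1).to_subtype
  obtain ⟨k, ⟨e⟩⟩ := Finite.exists_equiv_fin (P.cov ⁻¹' {1})
  choose x p hp using fun i => P.bundle.exists_proj_eq (e.symm i).1
  refine ⟨k, ⟨⟨x, p, fun i i' h => ?_, fun i => ?_, fun b hb => ⟨e ⟨b, hb⟩, ?_⟩⟩⟩⟩
  · simp only [hp] at h
    exact e.symm.injective (Subtype.ext h)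
  · rw [toX, hp]
    exact (e.symm i).2
  · rw [hp, e.symm_apply_apply]

namespace Frame

variable {P} {k : ℕ} (Φ : P.Frame k)

/-- The lift of the universal cover of the torus through a point of the frame. -/
noncomputable def lift (i : Fin k) : (Fin n → ℝ) → P.bundle.tot.obj (Φ.anchor i) :=
  (P.exists_lift (Φ.pt i) 0 (by rw [Φ.toX_pt, expMap_zero])).choose

theorem continuous_lift (i : Fin k) : Continuous (Φ.lift i) :=
  (P.exists_lift (Φ.pt i) 0 (by rw [Φ.toX_pt, expMap_zero])).choose_spec.1

theorem lift_zero (i : Fin k) : Φ.lift i 0 = Φ.pt i :=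
  (P.exists_lift (Φ.pt i) 0 (by rw [Φ.toX_pt, expMap_zero])).choose_spec.2.1

theorem toX_lift (i : Fin k) (v : Fin n → ℝ) : P.toX _ (Φ.lift i v) = expMap v :=
  (P.exists_lift (Φ.pt i) 0 (by rw [Φ.toX_pt, expMap_zero])).choose_spec.2.2 v

theorem continuous_map_lift {i : Fin k} {y : 𝒢} (h : Φ.anchor i ⟶ y) :
    Continuous fun v => P.bundle.tot.map h (Φ.lift i v) :=
  (P.bundle.tot.map h).hom.continuous.comp (Φ.continuous_lift i)

/-- Lifts that agree at one `v` agree everywhere, in particular at `0`, where the frame points have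
distinct images in `Y`. -/
theorem eq_of_map_lift_eq {i i' : Fin k} {y : 𝒢} {h : Φ.anchor i ⟶ y} {h' : Φ.anchor i' ⟶ y}
    {v : Fin n → ℝ} (e : P.bundle.tot.map h (Φ.lift i v) = P.bundle.tot.map h' (Φ.lift i' v)) :
    i = i' := by
  have h1 := P.lift_unique (Φ.continuous_map_lift h) (Φ.continuous_map_lift h')
    (fun v => by rw [toX_map, toX_map, toX_lift, toX_lift]) e
  have h2 := congrArg (P.bundle.proj y) (congrFun h1 0)
  rw [P.bundle.proj_map, P.bundle.proj_map, lift_zero, lift_zero] at h2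
  exact Φ.injective h2

theorem map_injective {y z : 𝒢} {g h : y ⟶ z} {p : P.bundle.tot.obj y}
    (e : P.bundle.tot.map g p = P.bundle.tot.map h p) : g = h :=
  (P.bundle.existsUnique_map_eq p (P.bundle.tot.map h p) (P.bundle.proj_map h p).symm).unique e rfl

/-- Translating a lift by a lattice vector gives another lift of `expMap`. Its value at `0` lies
over some frame point, and the arrow matching these two points matches the lifts everywhere by
uniqueness. -/
theorem exists_shift (j : Fin n) (i : Fin k) : ∃ (l : Fin k) (g : Φ.anchor i ⟶ Φ.anchor l),
    ∀ v, P.bundle.tot.map g (Φ.lift i (v + latticeVec (Pi.single j 1))) = Φ.lift l v := by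
  obtain ⟨l, hl⟩ := Φ.exists_proj_eq
    (P.bundle.proj _ (Φ.lift i (latticeVec (Pi.single j 1)))) (by
      have h1 := Φ.toX_lift i (latticeVec (Pi.single j 1))
      rwa [expMap_latticeVec] at h1)
  obtain ⟨g, hg, -⟩ := P.bundle.existsUnique_map_eq _ _ hl.symm
  refine ⟨l, g, congrFun (P.lift_unique (v₀ := 0) ?_ (Φ.continuous_lift l) (fun v => ?_) ?_)⟩
  · exact (Φ.continuous_map_lift g).comp (by fun_prop)
  · rw [toX_map, toX_lift, toX_lift, expMap_add_latticeVec]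
  · rw [zero_add, hg, lift_zero]

/-- The permutations of the holonomy. -/
noncomputable def shift (j : Fin n) (i : Fin k) : Fin k := (Φ.exists_shift j i).choose

/-- The arrows of the holonomy. -/
noncomputable def shiftArr (j : Fin n) (i l : Fin k) (h : Φ.shift j i = l) :
    Φ.anchor i ⟶ Φ.anchor l :=
  (Φ.exists_shift j i).choose_spec.choose ≫ eqToHom (congrArg Φ.anchor h)

theorem map_shiftArr {j : Fin n} {i l : Fin k} (h : Φ.shift j i = l) (v : Fin n → ℝ) :
    P.bundle.tot.map (Φ.shiftArr j i l h) (Φ.lift i (v + latticeVec (Pi.single j 1))) =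
      Φ.lift l v := by
  subst h
  have h1 : Φ.shiftArr j i _ rfl = (Φ.exists_shift j i).choose_spec.choose := Category.comp_id _
  rw [h1]
  exact (Φ.exists_shift j i).choose_spec.choose_spec v

theorem shift_injective (j : Fin n) : Function.Injective (Φ.shift j) := by
  intro i i' h
  have h1 := Φ.map_shiftArr (h : Φ.shift j i = Φ.shift j i') 0
  rw [← Φ.map_shiftArr (j := j) (i := i') rfl 0] at h1
  exact Φ.eq_of_map_lift_eq h1

/-- The holonomy of a `𝒢`-cover with respect to a frame. -/
noncomputable def holonomy : Inertia n (Wreath (Fin k) 𝒢) where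
  pt := ⟨Φ.anchor⟩
  aut j := Wreath.Hom.mk
    (Equiv.ofBijective (Φ.shift j) (Finite.injective_iff_bijective.1 (Φ.shift_injective j)))
    (Φ.shiftArr j)
  comm j j' := by
    -- Translations of `ℝⁿ` commute, so both composites of shifts start at the same point of the
    -- same lift. Comparing ends gives equal indices, and freeness of the action gives equal arrows.
    have key : ∀ (j j' : Fin n) (i l : Fin k) (h : Φ.shift j' (Φ.shift j i) = l),
        P.bundle.tot.map (Φ.shiftArr j i _ rfl ≫ Φ.shiftArr j' _ l h)
          (Φ.lift i (latticeVec (Pi.single j' 1) + latticeVec (Pi.single j 1))) = Φ.lift l 0 := by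
      intro j j' i l h
      have h1 := Φ.map_shiftArr (j := j) (i := i) rfl (0 + latticeVec (Pi.single j' 1))
      rw [zero_add] at h1
      rw [P.map_comp_apply, h1, ← Φ.map_shiftArr h 0, zero_add]
    have hp : ∀ i, Φ.shift j' (Φ.shift j i) = Φ.shift j (Φ.shift j' i) := by
      intro i
      have h1 := congrArg (P.bundle.proj _) (key j j' i _ rfl)
      have h2 := congrArg (P.bundle.proj _) (key j' j i _ rfl)
      rw [P.bundle.proj_map] at h1 h2
      rw [add_comm, h1, lift_zero, lift_zero] at h2
      exact Φ.injective h2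
    refine Wreath.Hom.ext' hp fun i l hf hg => ?_
    refine map_injective (p := Φ.lift i (latticeVec (Pi.single j' 1) + latticeVec (Pi.single j 1)))
      ((key j j' i l hf).trans ?_)
    rw [add_comm]
    exact (key j' j i l hg).symm

/-- The lift of the universal cover of the torus through a point of the fibre. -/
noncomputable def fibLift {y : 𝒢} (a : Φ.holonomy.Fib y) (v : Fin n → ℝ) : P.bundle.tot.obj y :=
  P.bundle.tot.map a.arr (Φ.lift a.idx v)

theorem continuous_fibLift {y : 𝒢} (a : Φ.holonomy.Fib y) : Continuous (Φ.fibLift a) :=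
  Φ.continuous_map_lift a.arr

theorem toX_fibLift {y : 𝒢} (a : Φ.holonomy.Fib y) (v : Fin n → ℝ) :
    P.toX y (Φ.fibLift a v) = expMap v :=
  (P.toX_map _ _).trans (Φ.toX_lift _ _)

theorem fibLift_comp {y z : 𝒢} (g : y ⟶ z) (a : Φ.holonomy.Fib y) (v : Fin n → ℝ) :
    Φ.fibLift (a.comp g) v = P.bundle.tot.map g (Φ.fibLift a v) :=
  P.map_comp_apply _ _ _

theorem fibLift_injective {y : 𝒢} {a b : Φ.holonomy.Fib y} {v : Fin n → ℝ}
    (h : Φ.fibLift a v = Φ.fibLift b v) : a = b := by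
  obtain ⟨i, g⟩ := a
  obtain ⟨i', g'⟩ := b
  obtain rfl : i = i' := Φ.eq_of_map_lift_eq h
  congr
  exact map_injective h

/-- For a generator this is the defining property of the shifts, inverted. It says that `fibLift`
respects the gluing relation of `Tw`, so that it descends to the quotient. -/
theorem fibLift_vadd {y : 𝒢} (m : Fin n → ℤ) (a : Φ.holonomy.Fib y) (v : Fin n → ℝ) :
    Φ.fibLift (m +ᵥ a) v = Φ.fibLift a (v + latticeVec m) := by
  revert a v
  refine lattice_induction (p := fun m => ∀ (a : Φ.holonomy.Fib y) v,
    Φ.fibLift (m +ᵥ a) v = Φ.fibLift a (v + latticeVec m)) (fun a v => by simp)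
    (fun m m' hm hm' a v => ?_) (fun m hm a v => ?_)
    (fun j a v => ?_) m
  · rw [add_vadd, hm, hm', latticeVec_add, add_assoc]
  · have h := hm (-m +ᵥ a) (v + latticeVec (-m))
    rw [vadd_vadd, add_neg_cancel, zero_vadd, add_assoc, ← latticeVec_add, neg_add_cancel,
      latticeVec_zero, add_zero] at h
    exact h.symm
  · rw [Inertia.single_vadd_fib]
    have h1 := Φ.map_shiftArr (j := j) (i := a.idx) rfl v
    change P.bundle.tot.map (Groupoid.inv (Φ.shiftArr j a.idx _ rfl) ≫ a.arr) (Φ.lift _ v) =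
      P.bundle.tot.map a.arr _
    have key : ∀ {b c : 𝒢} (g : b ⟶ c) (h : b ⟶ y), g ≫ Groupoid.inv g ≫ h = h := by simp
    rw [← h1, ← P.map_comp_apply]
    exact congrArg (fun u => P.bundle.tot.map u _) (key _ _)

/-- The comparison map between the cover with the holonomy of `P` and `P`. -/
noncomputable def compare {y : 𝒢} (p : Tw n (Φ.holonomy.Fib y)) : P.bundle.tot.obj y :=
  Φ.fibLift p.fib (Tw.exists_eq_mk p).choose

/-- The chosen representative differs from `(a, v)` by a lattice translation, under which `fibLift`
is compatible by `fibLift_vadd`. -/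
theorem compare_mk {y : 𝒢} (a : Φ.holonomy.Fib y) (v : Fin n → ℝ) :
    Φ.compare (Tw.mk a v) = Φ.fibLift a v := by
  obtain ⟨h1, h2⟩ := (Tw.exists_eq_mk (Tw.mk a v)).choose_spec
  rw [compare]
  obtain ⟨w, hw⟩ : ∃ w, w = (Tw.exists_eq_mk (Tw.mk a v)).choose := ⟨_, rfl⟩
  rw [← hw] at h1 h2 ⊢
  obtain ⟨m, rfl⟩ := expMap_eq_expMap.1 (congrArg Tw.pt h2 : expMap v = expMap w)
  have h3 : (Tw.mk a (w + latticeVec m)).fib = m +ᵥ a := by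
    simp [Tw.mk, floorVec_add_latticeVec, h1]
  rw [h3, fibLift_vadd]

theorem compare_bijective (y : 𝒢) :
    Function.Bijective (Φ.compare : Tw n (Φ.holonomy.Fib y) → P.bundle.tot.obj y) := by
  constructor
  · intro p q h
    obtain ⟨v, hv, hp⟩ := Tw.exists_eq_mk p
    obtain ⟨w, hw, hq⟩ := Tw.exists_eq_mk q
    rw [hp, hq] at h ⊢
    rw [compare_mk, compare_mk] at h
    have h1 := congrArg (P.toX y) h
    rw [toX_fibLift, toX_fibLift] at h1
    obtain ⟨m, rfl⟩ := expMap_eq_expMap.1 h1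
    -- Both representatives lie in the unit cube, so the lattice vector between them vanishes.
    rw [floorVec_add_latticeVec, hw, zero_add] at hv
    subst hv
    rw [latticeVec_zero, add_zero] at h ⊢
    rw [Φ.fibLift_injective h]
  · intro q
    obtain ⟨w, hw⟩ := expMap_surjective (P.toX y q)
    obtain ⟨F, hF, hF', hF''⟩ := P.exists_lift q w hw.symm
    -- Follow the lift through `q` back to `0`: there it lies over a frame point, and the arrow from
    -- that point gives the preimage.
    obtain ⟨i, hi⟩ := Φ.exists_proj_eq (P.bundle.proj y (F 0)) ((hF'' 0).trans expMap_zero)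
    obtain ⟨g, hg, -⟩ := P.bundle.existsUnique_map_eq _ _ hi
    let a : Φ.holonomy.Fib y := ⟨i, g⟩
    refine ⟨Tw.mk a w, ?_⟩
    have h1 : Φ.fibLift a = F := P.lift_unique (v₀ := 0) (Φ.continuous_fibLift a) hF
      (fun v => by rw [toX_fibLift, hF'']) (by
        rw [fibLift, ← hg]
        exact congrArg _ (Φ.lift_zero i))
    rw [compare_mk, h1, hF']

theorem exists_hom : Nonempty (Φ.holonomy.cover ⟶ P) := by
  refine exists_hom_of_bijective (P := Φ.holonomy.cover)
    (fun y => (Φ.compare : Tw n (Φ.holonomy.Fib y) → P.bundle.tot.obj y)) (fun y => ?_)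
    Φ.compare_bijective (fun {y z} g p => ?_) fun y p => ?_
  · refine Tw.continuous_iff.2 fun a => ?_
    simp_rw [compare_mk]
    exact Φ.continuous_fibLift a
  · obtain ⟨v, -, hp⟩ := Tw.exists_eq_mk (p : Tw n (Φ.holonomy.Fib y))
    rw [hp, compare_mk, ← fibLift_comp, ← compare_mk]
    exact congrArg Φ.compare (Tw.map_mk (Inertia.Fib.comp_vadd g) _ _)
  · obtain ⟨v, -, hp⟩ := Tw.exists_eq_mk (p : Tw n (Φ.holonomy.Fib y))
    rw [hp, compare_mk, toX_fibLift]
    rfl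

end Frame

theorem exists_cover_hom : ∃ (k : ℕ) (x : Inertia n (Wreath (Fin k) 𝒢)),
    Nonempty (x.cover ⟶ P) := by
  obtain ⟨k, ⟨Φ⟩⟩ := P.exists_frame
  exact ⟨k, Φ.holonomy, Φ.exists_hom⟩

end GCov

/-! ### The equivalence of groupoids. -/

/-- The functor from all the holonomy data to the `𝒢`-covers of the torus. -/
noncomputable def totalCoverFunctor (n : ℕ) (𝒢 : Type u) [Groupoid.{u} 𝒢] :
    (Σ k : ℕ, Inertia n (Wreath (Fin k) 𝒢)) ⥤ GCov 𝒢 (Torus n) :=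
  Sigma.desc fun k => Inertia.coverFunctor n (Fin k) 𝒢

instance (n : ℕ) (𝒢 : Type u) [Groupoid.{u} 𝒢] : (totalCoverFunctor n 𝒢).IsEquivalence where
  faithful := ⟨by
    rintro ⟨k, x⟩ ⟨l, x'⟩ ⟨f⟩ ⟨g⟩ h
    exact congrArg _ ((Inertia.coverFunctor n (Fin k) 𝒢).map_injective h)⟩
  full := ⟨by
    rintro ⟨k, x⟩ ⟨l, x'⟩ F
    -- Morphisms preserve the degree, so none connect different summands.
    obtain rfl : k = l := (x.isKFold_cover.of_hom F).eq (x := 1) x'.isKFold_cover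
    obtain ⟨f, hf⟩ := (Inertia.coverFunctor n (Fin k) 𝒢).map_surjective F
    exact ⟨.mk f, hf⟩⟩
  essSurj := ⟨fun P => by
    obtain ⟨k, x, ⟨F⟩⟩ := P.exists_cover_hom
    exact ⟨⟨k, x⟩, ⟨(Groupoid.isoEquivHom _ _).symm F⟩⟩⟩

/-! ### Open and closed subsets of a cover as stable sets. -/

namespace Inertia

variable {n k : ℕ} {𝒢 : Type u} [Groupoid.{u} 𝒢] (x : Inertia n (Wreath (Fin k) 𝒢))

theorem Stable.vadd_mem_iff {x : Inertia n (Wreath (Fin k) 𝒢)} {S : Finset (Fin k)}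
    (h : x.Stable S) (m : Fin n → ℤ) (a : x.Idx) : (m +ᵥ a).idx ∈ S ↔ a.idx ∈ S := by
  revert a
  refine lattice_induction (p := fun m => ∀ a : x.Idx, (m +ᵥ a).idx ∈ S ↔ a.idx ∈ S)
    (fun a => by simp) (fun m m' hm hm' a => ?_) (fun m hm a => ?_) (fun j a => ?_) m
  · rw [add_vadd, hm, hm']
  · have h1 := hm (-m +ᵥ a)
    rw [vadd_vadd, add_neg_cancel, zero_vadd] at h1
    exact h1.symm
  · rw [single_vadd_idx]
    exact h j a.idx

theorem Stable.isOpen {x : Inertia n (Wreath (Fin k) 𝒢)} {S : Finset (Fin k)} (h : x.Stable S) :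
    IsOpen {b : Tw n x.Idx | b.fib.idx ∈ S} := by
  refine Tw.isOpen_iff.2 fun a => ?_
  have : Tw.mk a ⁻¹' {b : Tw n x.Idx | b.fib.idx ∈ S} = {_v | a.idx ∈ S} := by
    ext v
    exact h.vadd_mem_iff _ _
  rw [this]
  exact isOpen_const

theorem Stable.isClopen {x : Inertia n (Wreath (Fin k) 𝒢)} {S : Finset (Fin k)} (h : x.Stable S) :
    IsClopen {b : Tw n x.Idx | b.fib.idx ∈ S} := by
  refine ⟨⟨?_⟩, h.isOpen⟩
  convert h.compl.isOpen using 1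
  ext b
  simp

/-- The preimage of `U` in the connected space `ℝⁿ` is empty or everything. Hence `U` is determined
by its trace on the fibre at `1`. -/
theorem mk_mem_iff_of_isClopen {A : Type*} [AddAction (Fin n → ℤ) A] {U : Set (Tw n A)}
    (hU : IsClopen U) (a : A) (v w : Fin n → ℝ) : Tw.mk a v ∈ U ↔ Tw.mk a w ∈ U := by
  rcases isClopen_iff.1 (hU.preimage (Tw.continuous_mk a)) with h | h
  · exact iff_of_false (fun hv => (h ▸ hv : v ∈ (∅ : Set (Fin n → ℝ))))
      fun hw => (h ▸ hw : w ∈ (∅ : Set (Fin n → ℝ)))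
  · exact iff_of_true (h ▸ Set.mem_univ v : v ∈ Tw.mk a ⁻¹' U)
      (h ▸ Set.mem_univ w : w ∈ Tw.mk a ⁻¹' U)

/-- An open and closed subset of the cover with holonomy `x` is given by a stable set of indices. -/
theorem exists_stable_of_isClopen {U : Set (Tw n x.Idx)} (hU : IsClopen U) :
    ∃ S : Finset (Fin k), x.Stable S ∧ ∀ b, b ∈ U ↔ b.fib.idx ∈ S := by
  classical
  refine ⟨Finset.univ.filter fun i => Tw.mk (⟨i⟩ : x.Idx) 0 ∈ U, fun j i => ?_, fun b => ?_⟩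
  · simp only [Finset.mem_filter, Finset.mem_univ, true_and]
    have h1 : Tw.mk (⟨(x.aut j).perm i⟩ : x.Idx) 0 =
        Tw.mk ⟨i⟩ (0 + latticeVec (Pi.single j 1)) := by
      rw [Tw.mk_add_latticeVec, single_vadd_idx]
    rw [h1]
    exact mk_mem_iff_of_isClopen hU _ _ _
  · obtain ⟨v, -, hb⟩ := Tw.exists_eq_mk b
    simp only [Finset.mem_filter, Finset.mem_univ, true_and]
    exact (iff_of_eq (congrArg (· ∈ U) hb)).trans (mk_mem_iff_of_isClopen hU _ v 0)

variable {x}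

/-- The inclusion of fibres for a restriction of holonomy data. -/
def Fib.incl {S : Finset (Fin k)} {h : x.Stable S} {a : ℕ} {ha : S.card = a} {y : 𝒢}
    (p : (x.restr S h ha).Fib y) : x.Fib y :=
  ⟨S.orderEmbOfFin ha p.idx, p.arr⟩

theorem Fib.incl_vadd {S : Finset (Fin k)} {h : x.Stable S} {a : ℕ} {ha : S.card = a} {y : 𝒢}
    (m : Fin n → ℤ) (p : (x.restr S h ha).Fib y) : (m +ᵥ p).incl = m +ᵥ p.incl := by
  refine equivariant_of_single (f := Fib.incl) (fun j p => ?_) m p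
  rw [single_vadd_fib, single_vadd_fib]
  exact (Fib.act_mk (x.aut j) (x.restr_perm S h ha j p.idx).symm p.arr).symm

theorem Fib.incl_injective {S : Finset (Fin k)} {h : x.Stable S} {a : ℕ} {ha : S.card = a} {y : 𝒢} :
    Function.Injective (Fib.incl : (x.restr S h ha).Fib y → x.Fib y) := by
  rintro ⟨i, g⟩ ⟨i', g'⟩ e
  obtain rfl : i = i' := (S.orderEmbOfFin ha).injective (congrArg Fib.idx e)
  have h1 : (⟨S.orderEmbOfFin ha i, g⟩ : x.Fib y) = ⟨S.orderEmbOfFin ha i, g'⟩ := e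
  congr
  exact eq_of_heq (Fib.mk.inj h1).2

theorem exists_hom_restrict (S : Finset (Fin k)) (h : x.Stable S) {a : ℕ} (ha : S.card = a)
    (U : TopologicalSpace.Clopens x.cover.base)
    (hU : ∀ b : Tw n x.Idx, b ∈ (U : Set x.cover.base) ↔ b.fib.idx ∈ S) :
    Nonempty ((x.restr S h ha).cover ⟶ x.cover.restrict U) := by
  refine GCov.exists_hom_of_bijective (P := (x.restr S h ha).cover) (Q := x.cover.restrict U)
    (fun y (p : Tw n ((x.restr S h ha).Fib y)) => ⟨(Tw.map Fib.incl p : Tw n (x.Fib y)),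
      (hU _).2 (Finset.orderEmbOfFin_mem S ha _)⟩) (fun y => ?_) (fun y => ⟨?_, ?_⟩)
    (fun g p => rfl) fun y p => rfl
  · exact (Tw.continuous_map Fib.incl_vadd).subtype_mk _
  · intro p q hpq
    have h1 : Tw.map Fib.incl p = Tw.map Fib.incl q := congrArg Subtype.val hpq
    exact Tw.ext (Fib.incl_injective (congrArg Tw.fib h1)) (congrArg Tw.pt h1 :)
  · rintro ⟨⟨⟨i, g⟩, t⟩, hq⟩
    have h1 : i ∈ S := (hU (Tw.pair ⟨i⟩ t)).1 hq
    rw [← Finset.mem_coe, ← Finset.range_orderEmbOfFin S ha] at h1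
    obtain ⟨i', rfl⟩ := h1
    exact ⟨(⟨⟨i', g⟩, t⟩ : Tw n ((x.restr S h ha).Fib y)), rfl⟩

end Inertia

/-! ### Class functions as functions on covers. -/

namespace SClass

variable {n : ℕ} {𝒢 : Type u} [Groupoid.{u} 𝒢] {R : Type v} [CommRing R]

/-- The restriction of invariant functions on `𝒢`-covers to holonomy data. -/
noncomputable def ofInvFun (n : ℕ) (𝒢 : Type u) [Groupoid.{u} 𝒢] (R : Type v) [CommRing R] :
    InvFun (GCov 𝒢 (Torus n)) R →ₐ[R] SClass n 𝒢 R where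
  toFun f k := InvFun.pullback (Inertia.coverFunctor n (Fin k) 𝒢) f
  map_one' := rfl
  map_mul' _ _ := rfl
  map_zero' := rfl
  map_add' _ _ := rfl
  commutes' _ := rfl

theorem ofInvFun_bijective : Function.Bijective (ofInvFun n 𝒢 R) := by
  constructor
  · intro f g h
    refine Subtype.ext (funext fun P => ?_)
    obtain ⟨k, x, ⟨F⟩⟩ := P.exists_cover_hom
    have e := (Groupoid.isoEquivHom _ _).symm F
    refine (f.2 _ _ ⟨e⟩).symm.trans (Eq.trans ?_ (g.2 _ _ ⟨e⟩))
    exact congrArg (fun s : SClass n 𝒢 R => s k x) h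
  · intro s
    -- A choice of holonomy for each cover extends `s` to covers; by fullness, and because the
    -- degree is an invariant, the value does not depend on the choice.
    have hs : ∀ {k l : ℕ} (x : Inertia n (Wreath (Fin k) 𝒢)) (x' : Inertia n (Wreath (Fin l) 𝒢)),
        Nonempty (x.cover ≅ x'.cover) → s k x = s l x' := by
      rintro k l x x' ⟨e⟩
      obtain rfl : k = l := (x.isKFold_cover.of_hom e.hom).eq (x := 1) x'.isKFold_cover
      exact (s k).2 _ _ ⟨(Inertia.coverFunctor n (Fin k) 𝒢).preimageIso e⟩
    choose k x F using fun P : GCov 𝒢 (Torus n) => P.exists_cover_hom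
    have e := fun P => (Groupoid.isoEquivHom _ _).symm (F P).some
    refine ⟨⟨fun P => s (k P) (x P), fun P Q ⟨g⟩ => hs _ _ ⟨e P ≪≫ g ≪≫ (e Q).symm⟩⟩, ?_⟩
    funext l
    exact Subtype.ext (funext fun x' => hs _ _ ⟨e _⟩)

/-- Functions on holonomy data are functions on `𝒢`-covers of the torus. -/
noncomputable def equivInvFun (n : ℕ) (𝒢 : Type u) [Groupoid.{u} 𝒢] (R : Type v) [CommRing R] :
    SClass n 𝒢 R ≃ₐ[R] InvFun (GCov 𝒢 (Torus n)) R :=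
  (AlgEquiv.ofBijective (ofInvFun n 𝒢 R) ofInvFun_bijective).symm

theorem equivInvFun_cover (s : SClass n 𝒢 R) {k : ℕ} (x : Inertia n (Wreath (Fin k) 𝒢)) :
    equivInvFun n 𝒢 R s x.cover = s k x := by
  have h := (AlgEquiv.ofBijective (ofInvFun n 𝒢 R) ofInvFun_bijective).apply_symm_apply s
  exact congrArg (fun s : SClass n 𝒢 R => s k x) h

theorem equivInvFun_apply (s : SClass n 𝒢 R) {k : ℕ} {x : Inertia n (Wreath (Fin k) 𝒢)}
    {P : GCov 𝒢 (Torus n)} (F : x.cover ⟶ P) : equivInvFun n 𝒢 R s P = s k x := by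
  rw [← equivInvFun_cover s x]
  exact ((equivInvFun n 𝒢 R s).2 _ _ ⟨(Groupoid.isoEquivHom _ _).symm F⟩).symm

/-- The cross product in terms of covers. -/
theorem equivInvFun_cross [∀ x y : 𝒢, Finite (x ⟶ y)] (s t : SClass n 𝒢 R)
    (P : GCov 𝒢 (Torus n)) : equivInvFun n 𝒢 R (cross s t) P =
      ∑ᶠ U : TopologicalSpace.Clopens P.base,
        equivInvFun n 𝒢 R s (P.restrict U) * equivInvFun n 𝒢 R t (P.restrict Uᶜ) := by
  classical
  obtain ⟨k, x, ⟨F⟩⟩ := P.exists_cover_hom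
  rw [equivInvFun_apply _ F, cross_apply]
  have hcl : ∀ S : {S : Finset (Fin k) // x.Stable S},
      ∃ V : TopologicalSpace.Clopens P.base, ∀ b : Tw n x.Idx, GCov.Hom.base F b ∈ V ↔
        b.fib.idx ∈ S.1 := by
    intro S
    refine ⟨⟨(GCov.Hom.baseHomeo F).symm ⁻¹' {b : Tw n x.Idx | b.fib.idx ∈ S.1},
      IsClopen.preimage S.2.isClopen (GCov.Hom.baseHomeo F).symm.continuous⟩, fun b => ?_⟩
    have h1 : (GCov.Hom.baseHomeo F).symm (GCov.Hom.base F b) = b :=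
      (GCov.Hom.baseHomeo F).symm_apply_apply b
    change ((GCov.Hom.baseHomeo F).symm (GCov.Hom.base F b) : Tw n x.Idx).fib.idx ∈ S.1 ↔ _
    rw [h1]
  choose V hV using hcl
  have hsurj : ∀ b, ∃ b', GCov.Hom.base F b' = b := (GCov.Hom.baseHomeo F).surjective
  have hbij : Function.Bijective V := by
    constructor
    · intro S S' h
      refine Subtype.ext (Finset.ext fun i => ?_)
      have h1 := hV S (⟨⟨i⟩, 1⟩ : Tw n x.Idx)
      rw [h, hV] at h1
      exact h1.symm
    · intro U
      obtain ⟨S, hS, hU⟩ := x.exists_stable_of_isClopen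
        (U.isClopen.preimage (GCov.Hom.continuous_base F))
      refine ⟨⟨S, hS⟩, SetLike.ext fun b => ?_⟩
      obtain ⟨b', rfl⟩ := hsurj b
      exact (hV _ b').trans (hU b').symm
  -- Restricting the holonomy to a stable set gives the holonomy of the restricted cover, first for
  -- `x.cover` and then for `P` along `F`.
  have hterm : ∀ (r : SClass n 𝒢 R) (S : Finset (Fin k)) (hS : x.Stable S)
      (W : TopologicalSpace.Clopens P.base),
      (∀ b : Tw n x.Idx, GCov.Hom.base F b ∈ W ↔ b.fib.idx ∈ S) →
      r S.card (x.restr S hS rfl) = equivInvFun n 𝒢 R r (P.restrict W) := by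
    intro r S hS W hW
    let U : TopologicalSpace.Clopens x.cover.base :=
      ⟨GCov.Hom.base F ⁻¹' W, W.isClopen.preimage (GCov.Hom.continuous_base F)⟩
    obtain ⟨f⟩ := Inertia.exists_hom_restrict S hS rfl U hW
    obtain ⟨g⟩ := GCov.exists_hom_restrict F U W fun b => Iff.rfl
    exact (equivInvFun_apply r (f ≫ g)).symm
  rw [← finsum_eq_sum_of_fintype]
  refine finsum_eq_of_bijective V hbij fun S => ?_
  rw [hterm s S.1 S.2 (V S) (hV S), hterm t S.1ᶜ S.2.compl (V S)ᶜ fun b => ?_]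
  rw [Finset.mem_compl, ← hV S b]
  rfl

end SClass

/-! ### Open and closed subsets as sets of components. -/

section Components

variable {Y : Type*} [TopologicalSpace Y]

theorem connectedSpace_iff_card_connectedComponents :
    ConnectedSpace Y ↔ Nat.card (_root_.ConnectedComponents Y) = 1 := by
  rw [Nat.card_eq_one_iff_unique]
  constructor
  · intro h
    exact ⟨inferInstance, inferInstance⟩
  · rintro ⟨h1, h2⟩
    have hne : Nonempty Y := ConnectedComponents.nonempty_iff_nonempty.1 h2
    have hp : PreconnectedSpace Y := preconnectedSpace_iff_connectedComponent.2 fun y =>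
      Set.eq_univ_of_forall fun z => ConnectedComponents.coe_eq_coe'.1 (Subsingleton.elim _ _)
    exact ⟨hne⟩

theorem card_connectedComponents_eq {Z : Type*} [TopologicalSpace Z] (e : Y ≃ₜ Z) :
    Nat.card (_root_.ConnectedComponents Y) = Nat.card (_root_.ConnectedComponents Z) :=
  Nat.card_congr
    { toFun := e.continuous.connectedComponentsMap
      invFun := e.symm.continuous.connectedComponentsMap
      left_inv := by
        intro C
        obtain ⟨y, rfl⟩ := ConnectedComponents.surjective_coe C
        simp [Continuous.connectedComponentsMap_mk]
      right_inv := by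
        intro C
        obtain ⟨y, rfl⟩ := ConnectedComponents.surjective_coe C
        simp [Continuous.connectedComponentsMap_mk] }

variable [Finite (_root_.ConnectedComponents Y)]

/-- The union of a set of connected components. -/
def TopologicalSpace.Clopens.ofComponents (V : Finset (_root_.ConnectedComponents Y)) :
    TopologicalSpace.Clopens Y where
  carrier := (↑) ⁻¹' (V : Set (_root_.ConnectedComponents Y))
  isClopen' := (isClopen_discrete _).preimage ConnectedComponents.continuous_coe

theorem TopologicalSpace.Clopens.mem_ofComponents {V : Finset (_root_.ConnectedComponents Y)}
    {y : Y} : y ∈ Clopens.ofComponents V ↔ (y : _root_.ConnectedComponents Y) ∈ V := Iff.rfl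

theorem TopologicalSpace.Clopens.ofComponents_compl [Fintype (_root_.ConnectedComponents Y)]
    [DecidableEq (_root_.ConnectedComponents Y)] (V : Finset (_root_.ConnectedComponents Y)) :
    Clopens.ofComponents Vᶜ = (Clopens.ofComponents V)ᶜ := by
  ext y
  simp [Clopens.ofComponents]

/-- An open and closed set contains the component of each of its points. Unions of components are
open and closed because the finite space of components is discrete. -/
theorem TopologicalSpace.Clopens.ofComponents_bijective :
    Function.Bijective (Clopens.ofComponents : Finset (_root_.ConnectedComponents Y) → _) := by
  constructor
  · intro V W h
    ext C
    obtain ⟨y, rfl⟩ := ConnectedComponents.surjective_coe C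
    rw [← mem_ofComponents, h, mem_ofComponents]
  · intro U
    classical
    let _ := Fintype.ofFinite (_root_.ConnectedComponents Y)
    refine ⟨(((↑) : Y → _root_.ConnectedComponents Y) '' U).toFinset, SetLike.ext fun y => ?_⟩
    rw [mem_ofComponents, Set.mem_toFinset]
    constructor
    · rintro ⟨z, hz, h⟩
      exact (U.isClopen.connectedComponent_subset hz) (ConnectedComponents.coe_eq_coe'.1 h.symm)
    · exact fun hy => ⟨y, hy, rfl⟩

/-- Components of `Y` that meet the subset lie inside it and stay preconnected in the subspace
topology, so they are its components too. -/
theorem TopologicalSpace.Clopens.card_components (V : Finset (_root_.ConnectedComponents Y)) :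
    Nat.card (_root_.ConnectedComponents (Clopens.ofComponents V).toOpens) = V.card := by
  let U := Clopens.ofComponents V
  have hc : Continuous (Subtype.val : U.toOpens → Y) := continuous_subtype_val
  have h1 : ∀ C, hc.connectedComponentsMap C ∈ V := by
    intro C
    obtain ⟨y, rfl⟩ := ConnectedComponents.surjective_coe C
    exact y.2
  rw [show V.card = Nat.card V by simp]
  refine Nat.card_congr (Equiv.ofBijective (fun C => ⟨hc.connectedComponentsMap C, h1 C⟩) ⟨?_, ?_⟩)
  · intro C D h
    obtain ⟨y, rfl⟩ := ConnectedComponents.surjective_coe C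
    obtain ⟨z, rfl⟩ := ConnectedComponents.surjective_coe D
    have h2 : (y.1 : _root_.ConnectedComponents Y) = z.1 := congrArg Subtype.val h
    rw [ConnectedComponents.coe_eq_coe'] at h2 ⊢
    have h3 : IsPreconnected ((Subtype.val : U.toOpens → Y) ⁻¹' connectedComponent z.1) := by
      have h4 : (Subtype.val : U.toOpens → Y) '' (Subtype.val ⁻¹' connectedComponent z.1) =
          connectedComponent z.1 := by
        refine Set.image_preimage_eq_of_subset fun w hw => ⟨⟨w, ?_⟩, rfl⟩
        exact U.isClopen.connectedComponent_subset z.2 hw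
      exact Topology.IsInducing.subtypeVal.isPreconnected_image.1
        (h4.symm ▸ isPreconnected_connectedComponent)
    exact h3.subset_connectedComponent (mem_connectedComponent (x := z.1)) h2
  · rintro ⟨C, hC⟩
    obtain ⟨y, rfl⟩ := ConnectedComponents.surjective_coe C
    exact ⟨ConnectedComponents.mk (⟨y, hC⟩ : U.toOpens), rfl⟩

end Components

/-! ### Degrees and components of covers. -/

namespace GCov

variable {n : ℕ} {𝒢 : Type u} [Groupoid.{u} 𝒢] (P : GCov 𝒢 (Torus n))

/-- Each point lies in the image of a map from `ℝⁿ`, so it shares a component with a point of the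
finite fibre at `1`. -/
instance : Finite (_root_.ConnectedComponents P.base) := by
  obtain ⟨k, x, ⟨F⟩⟩ := P.exists_cover_hom
  refine Finite.of_surjective (fun a : x.Idx =>
    (GCov.Hom.base F (Tw.mk a 0) : _root_.ConnectedComponents P.base)) fun C => ?_
  obtain ⟨b, rfl⟩ := ConnectedComponents.surjective_coe C
  obtain ⟨b', rfl⟩ : ∃ b', Hom.base F b' = b := (GCov.Hom.baseHomeo F).surjective b
  obtain ⟨v, -, hb⟩ := Tw.exists_eq_mk (b' : Tw n x.Idx)
  refine ⟨b'.fib, ?_⟩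
  have hc : Continuous fun v => Hom.base F (Tw.mk b'.fib v) :=
    (Hom.continuous_base F).comp (Tw.continuous_mk b'.fib)
  refine (ConnectedComponents.coe_eq_coe'.2 ?_).trans
    (congrArg (fun b => (Hom.base F b : _root_.ConnectedComponents P.base)) hb.symm)
  exact (isPreconnected_range hc).subset_connectedComponent ⟨v, rfl⟩ ⟨0, rfl⟩

/-- The degree of a finite cover of the torus. -/
noncomputable def deg : ℕ := (P.cov ⁻¹' {1}).ncard

theorem IsKFold.deg_eq {P : GCov 𝒢 (Torus n)} {k : ℕ} (h : P.IsKFold k) : P.deg = k := h 1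

theorem isKFold_deg : P.IsKFold P.deg := by
  obtain ⟨k, x, ⟨F⟩⟩ := P.exists_cover_hom
  have h := x.isKFold_cover.of_hom F
  rwa [h.deg_eq]

theorem exists_cover_hom_deg : ∃ x : Inertia n (Wreath (Fin P.deg) 𝒢), Nonempty (x.cover ⟶ P) := by
  obtain ⟨k, x, ⟨F⟩⟩ := P.exists_cover_hom
  obtain rfl := (x.isKFold_cover.of_hom F).deg_eq
  exact ⟨x, ⟨F⟩⟩

theorem deg_eq_zero_iff : P.deg = 0 ↔ IsEmpty P.base := by
  constructor
  · intro h
    refine ⟨fun b => ?_⟩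
    have h1 := P.isKFold_deg (P.cov b)
    rw [h, Set.ncard_eq_zero (P.finite_fibre _)] at h1
    exact (h1 ▸ (rfl : P.cov b = P.cov b) : b ∈ (∅ : Set P.base))
  · intro h
    rw [deg, Set.eq_empty_of_isEmpty (P.cov ⁻¹' {1}), Set.ncard_empty]

/-- The number of connected components of the cover. -/
noncomputable def numComponents : ℕ := Nat.card (_root_.ConnectedComponents P.base)

theorem numComponents_eq_one_iff : P.numComponents = 1 ↔ ConnectedSpace P.base :=
  connectedSpace_iff_card_connectedComponents.symm

theorem numComponents_eq_zero_iff : P.numComponents = 0 ↔ IsEmpty P.base := by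
  rw [numComponents, Finite.card_eq_zero_iff, ConnectedComponents.isEmpty_iff_isEmpty]

variable {P} in
theorem numComponents_eq_of_hom {Q : GCov 𝒢 (Torus n)} (F : P ⟶ Q) :
    P.numComponents = Q.numComponents :=
  card_connectedComponents_eq (Hom.baseHomeo F)

variable {P} in
theorem deg_eq_of_hom {Q : GCov 𝒢 (Torus n)} (F : P ⟶ Q) : P.deg = Q.deg :=
  Hom.ncard_fibre F 1

/-- The part of a `𝒢`-cover over a set of connected components. -/
noncomputable def part (V : Finset (_root_.ConnectedComponents P.base)) : GCov 𝒢 (Torus n) :=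
  P.restrict (.ofComponents V)

theorem numComponents_part (V : Finset (_root_.ConnectedComponents P.base)) :
    (P.part V).numComponents = V.card :=
  TopologicalSpace.Clopens.card_components V

theorem ncard_restrict_fibre (U : TopologicalSpace.Clopens P.base) (x : Torus n) :
    ((P.restrict U).cov ⁻¹' {x}).ncard = {b | P.cov b = x ∧ b ∈ U}.ncard := by
  have h : {b | P.cov b = x ∧ b ∈ U} =
      (Subtype.val : U.toOpens → P.base) '' ((P.restrict U).cov ⁻¹' {x}) := by
    ext b
    constructor
    · rintro ⟨h1, h2⟩
      exact ⟨⟨b, h2⟩, h1, rfl⟩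
    · rintro ⟨b, h1, rfl⟩
      exact ⟨h1, b.2⟩
  rw [h]
  exact (Set.ncard_image_of_injective _ Subtype.val_injective).symm

/-- The degree of a connected component. -/
noncomputable def compDeg (C : _root_.ConnectedComponents P.base) : ℕ := (P.part {C}).deg

theorem ncard_component_fibre (C : _root_.ConnectedComponents P.base) (x : Torus n) :
    {b | P.cov b = x ∧ (b : _root_.ConnectedComponents P.base) = C}.ncard = P.compDeg C := by
  rw [compDeg, ← (P.part {C}).isKFold_deg x, part, ncard_restrict_fibre]
  simp [TopologicalSpace.Clopens.mem_ofComponents]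

theorem one_le_compDeg (C : _root_.ConnectedComponents P.base) : 1 ≤ P.compDeg C := by
  rw [Nat.one_le_iff_ne_zero, compDeg, Ne, deg_eq_zero_iff, ← numComponents_eq_zero_iff,
    numComponents_part]
  simp

theorem sum_compDeg [Fintype (_root_.ConnectedComponents P.base)] :
    ∑ C, P.compDeg C = P.deg := by
  classical
  have hfin := P.finite_fibre 1
  rw [deg, Set.ncard_eq_toFinset_card _ hfin, Finset.card_eq_sum_card_fiberwise
    (f := ((↑) : P.base → _root_.ConnectedComponents P.base)) (t := Finset.univ)
    (fun _ _ => Finset.mem_coe.2 (Finset.mem_univ _))]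
  refine Finset.sum_congr rfl fun C _ => ?_
  rw [← ncard_component_fibre P C 1, ← Set.ncard_coe_finset]
  congr 1
  ext b
  simp

theorem numComponents_le_deg : P.numComponents ≤ P.deg := by
  let _ := Fintype.ofFinite (_root_.ConnectedComponents P.base)
  rw [← P.sum_compDeg, numComponents, Nat.card_eq_fintype_card, Fintype.card_eq_sum_ones]
  exact Finset.sum_le_sum fun C _ => P.one_le_compDeg C

theorem exists_hom_part_univ [Fintype (_root_.ConnectedComponents P.base)] :
    Nonempty (P.part Finset.univ ⟶ P) := by
  have hU : ∀ b : P.base, b ∈ TopologicalSpace.Clopens.ofComponents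
      (Finset.univ : Finset (_root_.ConnectedComponents P.base)) := fun b => Finset.mem_univ _
  refine exists_hom_of_bijective (P := P.part Finset.univ) (fun x p => p.1) (fun x => ?_)
    (fun x => ⟨?_, ?_⟩) (fun _ _ => rfl) fun _ _ => rfl
  · exact continuous_subtype_val
  · exact Subtype.val_injective
  · exact fun p => ⟨⟨p, hU _⟩, rfl⟩

end GCov

/-! ### The truncated logarithm series at `e^X - 1`. -/

section Logarithm

open PowerSeries

theorem PowerSeries.coeff_exp_sub_one (m : ℕ) :
    coeff m (exp ℚ - 1) = if m = 0 then 0 else 1 / (m.factorial : ℚ) := by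
  rw [map_sub, coeff_exp, coeff_one]
  split_ifs with h <;> simp [h]

theorem PowerSeries.coeff_exp_sub_one_pow_of_lt {m N : ℕ} (h : m < N) :
    coeff m ((exp ℚ - 1) ^ N) = 0 := by
  have h1 : (X : ℚ⟦X⟧) ∣ exp ℚ - 1 := X_dvd_iff.2 (by simp)
  exact X_pow_dvd_iff.1 (pow_dvd_pow_of_dvd h1 N) m h

/-- The logarithm series, evaluated at `exp X - 1`. -/
theorem PowerSeries.sum_log_exp_sub_one {m N : ℕ} (h : m ≤ N) :
    ∑ j ∈ Finset.Icc 1 N, (-1 : ℚ) ^ (j - 1) / j * (m.factorial * coeff m ((exp ℚ - 1) ^ j)) =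
      if m = 1 then 1 else 0 := by
  set A : ℚ⟦X⟧ := exp ℚ - 1 with hA
  have hdA : d⁄dX ℚ A = 1 - -A := by
    rw [hA, map_sub, PowerSeries.derivative_exp, ← map_one (C : ℚ →+* ℚ⟦X⟧), derivative_C]
    simp
  rcases m with _ | m
  · rw [if_neg (by simp)]
    refine Finset.sum_eq_zero fun j hj => ?_
    rw [coeff_exp_sub_one_pow_of_lt (Finset.mem_Icc.1 hj).1]
    simp
  · let L : ℚ⟦X⟧ := ∑ j ∈ Finset.Icc 1 N, ((-1 : ℚ) ^ (j - 1) / j) • A ^ j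
    -- Since `A' = 1 + A`, the derivative of the truncated logarithm is a geometric sum in `-A`
    -- times `1 - (-A)`, which telescopes.
    have hL : d⁄dX ℚ L = 1 - (-A) ^ N := by
      rw [← geom_sum_mul_neg (-A) N, ← hdA, map_sum, Finset.sum_mul,
        Finset.range_eq_Ico, Finset.sum_Ico_eq_sum_range]
      rw [show Finset.Icc 1 N = Finset.Ico 1 (N + 1) from rfl,
        Finset.sum_Ico_eq_sum_range]
      refine Finset.sum_congr (by simp) fun j _ => ?_
      rw [Derivation.map_smul, Derivation.leibniz_pow]
      simp only [add_tsub_cancel_left, zero_add, smul_eq_mul]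
      rw [← Nat.cast_smul_eq_nsmul ℚ, smul_smul, div_mul_cancel₀ _ (by positivity), neg_pow A,
        smul_eq_C_mul]
      simp
      ring
    -- The error `(-A) ^ N` is divisible by `X ^ N`, and `m < N`, so `L` agrees with `X` in the
    -- degree considered.
    have h1 : coeff (m + 1) L * (m + 1) = if m = 0 then 1 else 0 := by
      rw [← coeff_derivative, hL, map_sub, neg_pow, ← map_one (C : ℚ →+* ℚ⟦X⟧), ← map_neg,
       ← map_pow,
        coeff_C_mul, coeff_exp_sub_one_pow_of_lt h, map_one, coeff_one]
      simp
    have h2 : ∑ j ∈ Finset.Icc 1 N,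
        (-1 : ℚ) ^ (j - 1) / j * ((m + 1).factorial * coeff (m + 1) (A ^ j)) =
        m.factorial * (coeff (m + 1) L * (m + 1)) := by
      rw [map_sum, Finset.sum_mul, Finset.mul_sum]
      refine Finset.sum_congr rfl fun j _ => ?_
      rw [coeff_smul, Nat.factorial_succ]
      push_cast
      simp only [smul_eq_mul]
      ring
    rw [h2, h1]
    by_cases hm : m = 0 <;> simp [hm]

end Logarithm

/-! ### The unit of the juxtaproduct under the cross product. -/

namespace SClass

variable {n : ℕ} {𝒢 : Type u} [Groupoid.{u} 𝒢] {R : Type v} [CommRing R]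

theorem _root_.InvFun.eq_of_hom {C : Type*} [Groupoid C] (f : InvFun C R) {x y : C} (F : x ⟶ y) :
    f x = f y :=
  f.2 _ _ ⟨(Groupoid.isoEquivHom _ _).symm F⟩

theorem equivInvFun_one (P : GCov 𝒢 (Torus n)) : equivInvFun n 𝒢 R 1 P = 1 := by
  rw [map_one]
  rfl

theorem equivInvFun_crossOne (P : GCov 𝒢 (Torus n)) :
    equivInvFun n 𝒢 R crossOne P = if P.numComponents = 0 then 1 else 0 := by
  obtain ⟨k, x, ⟨F⟩⟩ := P.exists_cover_hom
  have hk : P.numComponents = 0 ↔ k = 0 := by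
    rw [P.numComponents_eq_zero_iff, ← P.deg_eq_zero_iff, (x.isKFold_cover.of_hom F).deg_eq]
  rw [equivInvFun_apply _ F, crossOne]
  split_ifs with h
  · obtain rfl := hk.1 h
    rfl
  · rw [Pi.single_eq_of_ne (mt hk.2 h)]
    rfl

theorem equivInvFun_smul (a : ℕ → R) (s : SClass n 𝒢 R) (P : GCov 𝒢 (Torus n)) :
    equivInvFun n 𝒢 R (fun k => a k • s k) P = a P.deg * equivInvFun n 𝒢 R s P := by
  obtain ⟨x, ⟨F⟩⟩ := P.exists_cover_hom_deg
  rw [equivInvFun_apply _ F, equivInvFun_apply _ F]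
  rfl

/-- The degree of the connected covers. -/
noncomputable def connectedDeg (n : ℕ) (𝒢 : Type u) [Groupoid.{u} 𝒢] (R : Type v) [CommRing R] :
    InvFun (GCov 𝒢 (Torus n)) R :=
  ⟨fun P => if P.numComponents = 1 then (P.deg : R) else 0, fun P Q ⟨F⟩ => by
    simp only [GCov.numComponents_eq_of_hom F.hom, GCov.deg_eq_of_hom F.hom]⟩

/-- Only single components contribute, and their degrees add up to that of the cover. -/
theorem sum_connectedDeg_part (P : GCov 𝒢 (Torus n))
    [Fintype (_root_.ConnectedComponents P.base)] :
    ∑ V : Finset (_root_.ConnectedComponents P.base), connectedDeg n 𝒢 R (P.part V) = P.deg := by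
  classical
  simp only [connectedDeg, P.numComponents_part]
  rw [← Finset.sum_filter, ← P.sum_compDeg, Nat.cast_sum]
  have h1 : (Finset.univ.filter fun V : Finset (_root_.ConnectedComponents P.base) => V.card = 1) =
      Finset.univ.map ⟨singleton, Finset.singleton_injective⟩ := by
    ext V
    simp [Finset.card_eq_one, eq_comm]
  rw [h1, Finset.sum_map]
  rfl

variable [∀ x y : 𝒢, Finite (x ⟶ y)]

open Classical in
theorem equivInvFun_cross_eq_sum (s t : SClass n 𝒢 R) (P : GCov 𝒢 (Torus n))
    [Fintype (_root_.ConnectedComponents P.base)] :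
    equivInvFun n 𝒢 R (cross s t) P = ∑ V : Finset (_root_.ConnectedComponents P.base),
      equivInvFun n 𝒢 R s (P.part V) * equivInvFun n 𝒢 R t (P.part Vᶜ) := by
  rw [equivInvFun_cross, ← finsum_eq_sum_of_fintype]
  refine (finsum_eq_of_bijective _ TopologicalSpace.Clopens.ofComponents_bijective
    fun V => ?_).symm
  rw [← TopologicalSpace.Clopens.ofComponents_compl]
  rfl

theorem equivInvFun_cross_one (s : SClass n 𝒢 R) (P : GCov 𝒢 (Torus n))
    [Fintype (_root_.ConnectedComponents P.base)] :
    equivInvFun n 𝒢 R (cross 1 s) P = ∑ V : Finset (_root_.ConnectedComponents P.base),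
      equivInvFun n 𝒢 R s (P.part V) := by
  classical
  rw [equivInvFun_cross_eq_sum]
  simp only [equivInvFun_one, one_mul]
  exact Fintype.sum_equiv (Equiv.mk compl compl compl_compl compl_compl) _ _ fun V => rfl

/-- The value of `𝟏 × s` at `P` is `s` at `P` plus values of `s` at covers with fewer components.
Induction on the number of components thus recovers `s`, over every ring. -/
theorem cross_one_injective : Function.Injective (cross (1 : SClass n 𝒢 R)) := by
  classical
  intro s t h
  refine (equivInvFun n 𝒢 R).injective (Subtype.ext (funext fun P => ?_))
  induction hm : P.numComponents using Nat.strong_induction_on generalizing P with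
  | _ m ih =>
    let _ := Fintype.ofFinite (_root_.ConnectedComponents P.base)
    have h1 := congrArg (fun r => equivInvFun n 𝒢 R r P) h
    simp only [equivInvFun_cross_one] at h1
    rw [← Finset.add_sum_erase _ _ (Finset.mem_univ Finset.univ),
      ← Finset.add_sum_erase (a := Finset.univ) _ _ (Finset.mem_univ Finset.univ)] at h1
    obtain ⟨F⟩ := P.exists_hom_part_univ
    rw [InvFun.eq_of_hom _ F, InvFun.eq_of_hom _ F] at h1
    refine add_right_cancel (h1.trans (congrArg _ (Eq.symm ?_)))
    refine Finset.sum_congr rfl fun V hV => ih V.card ?_ _ (P.numComponents_part V)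
    rw [← hm, GCov.numComponents, Nat.card_eq_fintype_card]
    exact (Finset.card_lt_iff_ne_univ V).2 (Finset.mem_erase.1 hV).1

/-! ### The elements `c_k` -/

theorem isC_symm_connectedDeg : IsC ((equivInvFun n 𝒢 R).symm (connectedDeg n 𝒢 R)) := by
  constructor
  · refine Subtype.ext (funext fun x => ?_)
    rw [← equivInvFun_cover, AlgEquiv.apply_symm_apply]
    have h1 : x.cover.numComponents = 0 := by
      rw [GCov.numComponents_eq_zero_iff, ← GCov.deg_eq_zero_iff, x.isKFold_cover.deg_eq]
    exact if_neg (by rw [h1]; exact zero_ne_one)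
  · refine (equivInvFun n 𝒢 R).injective (Subtype.ext (funext fun P => ?_))
    let _ := Fintype.ofFinite (_root_.ConnectedComponents P.base)
    have h1 : (fun k : ℕ => k • (1 : NClass n (Wreath (Fin k) 𝒢) R)) =
        fun k : ℕ => (k : R) • (1 : SClass n 𝒢 R) k :=
      funext fun k : ℕ => (Nat.cast_smul_eq_nsmul R k _).symm
    rw [h1, equivInvFun_smul (fun k => (k : R)), equivInvFun_one, mul_one, equivInvFun_cross_one,
      AlgEquiv.apply_symm_apply, sum_connectedDeg_part]

theorem IsC.eq {c : SClass n 𝒢 R} (hc : IsC c) :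
    c = (equivInvFun n 𝒢 R).symm (connectedDeg n 𝒢 R) :=
  cross_one_injective (hc.2.trans isC_symm_connectedDeg.2.symm)

theorem existsUnique_isC : ∃! c : SClass n 𝒢 R, IsC c :=
  ⟨_, isC_symm_connectedDeg, fun _ hc => hc.eq⟩

theorem IsC.apply {c : SClass n 𝒢 R} (hc : IsC c) {P : GCov 𝒢 (Torus n)} {k : ℕ}
    (h : P.IsKFold k) : (ConnectedSpace P.base → equivInvFun n 𝒢 R c P = (k : R)) ∧
      (¬ ConnectedSpace P.base → equivInvFun n 𝒢 R c P = 0) := by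
  rw [hc.eq, AlgEquiv.apply_symm_apply, ← P.numComponents_eq_one_iff, ← h.deg_eq]
  exact ⟨fun h => if_pos h, fun h => if_neg h⟩

/-! ### The elements `f_k` -/

/-- The sign given by the parity of the number of components. -/
noncomputable def componentSign (n : ℕ) (𝒢 : Type u) [Groupoid.{u} 𝒢] (R : Type v) [CommRing R] :
    InvFun (GCov 𝒢 (Torus n)) R :=
  ⟨fun P => (-1) ^ P.numComponents, fun P Q ⟨F⟩ => by
    simp only [GCov.numComponents_eq_of_hom F.hom]⟩

/-- The sum of `(-1) ^ |V|` over all subsets `V` of a finite set is zero unless the set is empty. -/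
theorem cross_one_symm_componentSign :
    cross 1 ((equivInvFun n 𝒢 R).symm (componentSign n 𝒢 R)) = crossOne := by
  classical
  refine (equivInvFun n 𝒢 R).injective (Subtype.ext (funext fun P => ?_))
  let _ := Fintype.ofFinite (_root_.ConnectedComponents P.base)
  rw [equivInvFun_cross_one, AlgEquiv.apply_symm_apply, equivInvFun_crossOne]
  simp only [componentSign, P.numComponents_part]
  have h1 := Finset.sum_powerset_neg_one_pow_card
    (x := (Finset.univ : Finset (_root_.ConnectedComponents P.base)))
  rw [Finset.powerset_univ] at h1
  have h2 := congrArg (Int.cast : ℤ → R) h1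
  push_cast at h2
  rw [h2]
  refine if_congr ?_ rfl rfl
  rw [GCov.numComponents, Finite.card_eq_zero_iff, Finset.univ_eq_empty_iff]

/-- The sign twist by `(-1) ^ k` is an involution, so the equation for `f` determines `f` by
`cross_one_injective`. -/
theorem isF_iff {f : SClass n 𝒢 R} : IsF f ↔
    f = fun k => (-1 : R) ^ k • (equivInvFun n 𝒢 R).symm (componentSign n 𝒢 R) k := by
  have hs : Function.Involutive fun (f : SClass n 𝒢 R) k => (-1 : R) ^ k • f k := fun f =>
    funext fun k => by
      simp only [smul_smul, ← mul_pow, neg_one_mul, neg_neg, one_pow, one_smul]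
  rw [IsF, ← cross_one_symm_componentSign, cross_one_injective.eq_iff]
  exact hs.eq_iff

theorem existsUnique_isF : ∃! f : SClass n 𝒢 R, IsF f :=
  ⟨_, isF_iff.2 rfl, fun _ hf => isF_iff.1 hf⟩

/-- The value is `(-1) ^ k` times the sign of the number of components; as `k` is the sum of the
degrees `k_i`, each component receives the exponent `k_i - 1`, up to an even number. -/
theorem IsF.apply {f : SClass n 𝒢 R} (hf : IsF f) (P : GCov 𝒢 (Torus n)) :
    equivInvFun n 𝒢 R f P = ∏ᶠ C, (-1 : R) ^ (P.compDeg C - 1) := by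
  let _ := Fintype.ofFinite (_root_.ConnectedComponents P.base)
  rw [isF_iff.1 hf, equivInvFun_smul, AlgEquiv.apply_symm_apply, finprod_eq_prod_of_fintype,
    Finset.prod_pow_eq_pow_sum]
  have h1 : P.deg = ∑ C, (P.compDeg C - 1) + P.numComponents := by
    rw [← P.sum_compDeg, GCov.numComponents, Nat.card_eq_fintype_card, Fintype.card_eq_sum_ones,
      ← Finset.sum_add_distrib]
    exact Finset.sum_congr rfl fun C _ => (Nat.sub_add_cancel (P.one_le_compDeg C)).symm
  change (-1) ^ P.deg * (-1) ^ P.numComponents = _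
  rw [h1, pow_add, mul_assoc, ← mul_pow, neg_one_mul, neg_neg, one_pow, mul_one]

/-! ### The logarithm of the unit of the juxtaproduct -/

/-- The factor `𝟏 - 1₀` is the indicator of nonempty covers, so its `j`-th power counts the ordered
partitions of the set of components into `j` nonempty parts. Their exponential generating function
is `(e^X - 1) ^ j`. -/
theorem equivInvFun_crossPow [Algebra ℚ R] (j : ℕ) (P : GCov 𝒢 (Torus n)) :
    equivInvFun n 𝒢 R (crossPow (1 - crossOne) j) P = algebraMap ℚ R
      (P.numComponents.factorial *
        PowerSeries.coeff P.numComponents ((PowerSeries.exp ℚ - 1) ^ j)) := by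
  classical
  induction j generalizing P with
  | zero =>
    rw [crossPow, equivInvFun_crossOne, pow_zero, PowerSeries.coeff_one]
    split_ifs with h <;> simp [h]
  | succ j ih =>
    let _ := Fintype.ofFinite (_root_.ConnectedComponents P.base)
    have hcard : P.numComponents =
        (Finset.univ : Finset (_root_.ConnectedComponents P.base)).card := by
      rw [GCov.numComponents, Nat.card_eq_fintype_card, Finset.card_univ]
    set m := P.numComponents with hm
    let g : ℕ → R := fun i => algebraMap ℚ R
      (i.factorial * PowerSeries.coeff i ((PowerSeries.exp ℚ - 1) ^ j)) *
        (1 - if m - i = 0 then 1 else 0)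
    have h1 : equivInvFun n 𝒢 R (crossPow (1 - crossOne) (j + 1)) P =
        ∑ V ∈ (Finset.univ : Finset (_root_.ConnectedComponents P.base)).powerset, g V.card := by
      rw [crossPow, equivInvFun_cross_eq_sum, Finset.powerset_univ]
      refine Finset.sum_congr rfl fun V _ => ?_
      have h2 : equivInvFun n 𝒢 R (1 - crossOne) (P.part Vᶜ) =
          1 - if m - V.card = 0 then 1 else 0 := by
        rw [map_sub]
        change equivInvFun n 𝒢 R 1 _ - equivInvFun n 𝒢 R crossOne _ = _
        rw [equivInvFun_one, equivInvFun_crossOne, P.numComponents_part, Finset.card_compl, hcard,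
          Finset.card_univ]
      rw [ih, h2, P.numComponents_part]
    -- Grouping the subsets by size brings in binomial coefficients, which turn the sum into a
    -- product of exponential generating functions.
    rw [h1, Finset.sum_powerset_apply_card, ← hcard, pow_succ, PowerSeries.coeff_mul,
      Finset.Nat.sum_antidiagonal_eq_sum_range_succ_mk, Finset.mul_sum, map_sum]
    refine Finset.sum_congr rfl fun i hi => ?_
    have hi' : i ≤ m := Nat.lt_succ_iff.1 (Finset.mem_range.1 hi)
    simp only [g, PowerSeries.coeff_exp_sub_one]
    split_ifs with h
    · simp
    · rw [sub_zero, mul_one, nsmul_eq_mul, ← map_natCast (algebraMap ℚ R), ← map_mul,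
        Nat.cast_choose ℚ hi']
      congr 1
      have := Nat.factorial_ne_zero i
      have := Nat.factorial_ne_zero (m - i)
      field_simp

theorem equivInvFun_crossLog_one [Algebra ℚ R] (P : GCov 𝒢 (Torus n)) :
    equivInvFun n 𝒢 R (crossLog 1) P = if P.numComponents = 1 then 1 else 0 := by
  obtain ⟨x, ⟨F⟩⟩ := P.exists_cover_hom_deg
  have h1 : equivInvFun n 𝒢 R (crossLog 1) P = ∑ j ∈ Finset.Icc 1 P.deg,
      algebraMap ℚ R ((-1) ^ (j - 1) / j) *
        equivInvFun n 𝒢 R (crossPow (1 - crossOne) j) P := by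
    rw [equivInvFun_apply _ F, crossLog, AddSubmonoidClass.coe_finsetSum, Finset.sum_apply]
    refine Finset.sum_congr rfl fun j _ => ?_
    rw [equivInvFun_apply _ F]
    rfl
  -- The logarithm is truncated at the degree of the cover, not at its number of components; this
  -- suffices because the latter is at most the former.
  have h2 := congrArg (algebraMap ℚ R) (PowerSeries.sum_log_exp_sub_one P.numComponents_le_deg)
  rw [map_sum] at h2
  simp only [h1, equivInvFun_crossPow]
  simp only [map_mul (algebraMap ℚ R) (_ / _)] at h2
  rw [h2]
  split_ifs <;> simp

end SClass

theorem mainTheorem5 (n : ℕ) (𝒢 : Type u) [Groupoid.{u} 𝒢] [Finite 𝒢]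
    [∀ x y : 𝒢, Finite (x ⟶ y)] :
    ∃ E : (Σ k : ℕ, Inertia n (Wreath (Fin k) 𝒢)) ≌ GCov 𝒢 (Torus n),
      -- the `k`-th summand corresponds to the `k`-fold covers, and `E` is given by holonomy
      (∀ k x, (E.functor.obj ⟨k, x⟩).IsKFold k ∧ (E.functor.obj ⟨k, x⟩).HasHolonomy x) ∧
      ∀ (R : Type v) [CommRing R],
        -- restriction along `E` is an isomorphism of algebras for the pointwise products
        ∃ Φ : SClass n 𝒢 R ≃ₐ[R] InvFun (GCov 𝒢 (Torus n)) R,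
          (∀ s k x, Φ s (E.functor.obj ⟨k, x⟩) = s k x) ∧
          -- the cross product and its unit in terms of covers
          (∀ s t P, Φ (SClass.cross s t) P =
            ∑ᶠ U : TopologicalSpace.Clopens P.base, Φ s (P.restrict U) * Φ t (P.restrict Uᶜ)) ∧
          (∀ P, (IsEmpty P.base → Φ SClass.crossOne P = 1) ∧
            (Nonempty P.base → Φ SClass.crossOne P = 0)) ∧
          -- the elements `c_k`
          (∃! c : SClass n 𝒢 R, SClass.IsC c) ∧
          (∀ c : SClass n 𝒢 R, SClass.IsC c → ∀ (P : GCov 𝒢 (Torus n)) (k : ℕ), P.IsKFold k →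
            (ConnectedSpace P.base → Φ c P = (k : R)) ∧ (¬ ConnectedSpace P.base → Φ c P = 0)) ∧
          -- the coefficients of the logarithm of `𝟏`
          (∀ _ : Algebra ℚ R, ∀ P,
            (ConnectedSpace P.base → Φ (SClass.crossLog 1) P = 1) ∧
            (¬ ConnectedSpace P.base → Φ (SClass.crossLog 1) P = 0)) ∧
          -- the elements `f_k`
          (∃! f : SClass n 𝒢 R, SClass.IsF f) ∧
          (∀ f : SClass n 𝒢 R, SClass.IsF f → ∀ P : GCov 𝒢 (Torus n),
            ∃ d : _root_.ConnectedComponents P.base → ℕ,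
            (∀ C, 1 ≤ d C ∧ ∀ x, {y | P.cov y = x ∧ (y : _root_.ConnectedComponents P.base) = C}.ncard
              = d C) ∧
            Φ f P = ∏ᶠ C, (-1 : R) ^ (d C - 1)) := by
  refine ⟨(totalCoverFunctor n 𝒢).asEquivalence,
    fun k x => ⟨x.isKFold_cover, x.hasHolonomy_cover⟩, fun R _ => ⟨SClass.equivInvFun n 𝒢 R,
      fun s k x => SClass.equivInvFun_cover s x, SClass.equivInvFun_cross, fun P => ⟨?_, ?_⟩,
      SClass.existsUnique_isC, fun c hc P k h => hc.apply h, fun _ P => ⟨?_, ?_⟩,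
      SClass.existsUnique_isF, fun f hf P => ⟨P.compDeg,
        fun C => ⟨P.one_le_compDeg C, P.ncard_component_fibre C⟩, hf.apply P⟩⟩⟩
  · intro h
    rw [SClass.equivInvFun_crossOne, if_pos (P.numComponents_eq_zero_iff.2 h)]
  · intro h
    rw [SClass.equivInvFun_crossOne, if_neg]
    exact fun h' => not_isEmpty_of_nonempty P.base (P.numComponents_eq_zero_iff.1 h')
  · intro h
    rw [SClass.equivInvFun_crossLog_one, if_pos (P.numComponents_eq_one_iff.2 h)]
  · intro h
    rw [SClass.equivInvFun_crossLog_one, if_neg (mt P.numComponents_eq_one_iff.1 h)]
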